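/- A quantum space is a complex vector space $E$ (not assumed complete) with a norm on each matrix space $M_n(E)$, $n\ge 1$, satisfying Ruan's axioms $\|v\oplus w\|=\max(\|v\|,\|w\|)$ and $\|\alpha v\beta\|\le\|\alpha\|\,\|v\|\,\|\beta\|$ for scalar matrices $\alpha,\beta$ with their operator norms. For a linear operator $\varphi:F\to E$ between quantum spaces let $\varphi_n:M_n(F)\to M_n(E)$ be its entrywise amplification and $\|\varphi\|_{cb}=\sup_n\|\varphi_n\|$; $\varphi$ is completely bounded if $\|\varphi\|_{cb}<\infty$, completely contractive (completely isometric) if every $\varphi_n$ is contractive (isometric), and completely strictly coisometric if every $\varphi_n$ maps the closed unit ball of $M_n(F)$ onto that of $M_n(E)$. A quantum space $P$ is metrically projective if for every completely strictly coisometric $\tau:F\to E$ between quantum spaces and every completely bounded $\varphi:P\to E$ there is a completely bounded $\psi:P\to F$ with $\tau\psi=\varphi$ and $\|\psi\|_{cb}=\|\varphi\|_{cb}$. For $n\ge1$ let $\mathcal N_n$ be the space of trace class operators on $\mathbb C^n$ with the quantum norm of the quantum dual of $\mathcal B(\mathbb C^n)$: $\|[w_{ij}]\|_{M_k(\mathcal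 N_n)}$ is the completely bounded norm of $\mathcal B(\mathbb C^n)\to M_k$, $a\mapsto[\operatorname{tr}(w_{ij}a)]$. The $\oplus_1$-sum of a family of quantum spaces is its coproduct in the category of quantum spaces and completely contractive operators, that is, the algebraic direct sum with the largest quantum norm for which the natural embeddings of the summands are completely contractive. A nuclear-composed space is an $\oplus_1$-sum of a family of spaces each of which is some $\mathcal N_n$, $n\ge1$. Then: (i) For every quantum space $E$ there are a nuclear-composed space $X$ and a completely strictly coisometric operator $\tau:X\to E$. (ii) For a quantum space $P$ the following are equivalent: (a) $P$ is metrically projective; (b) $P$ is a retract, by completely contractive operators, of a nuclear-composed space $X$, i.e. there are completely contractive $\sigma:X\to P$ and $\rho:P\to X$ with $\sigma\rho=\mathbf 1_P$; (c) $P$ is completely isometrically isomorphic to the range of a linear projection $\pi$ of a nuclear-composed space, where $\|\pi\|_{cb}=1$ if $P\ne0$. In particular, every $\mathcal N_n$, $n\ge1$, is metrically projective. -/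

import Mathlib

universe u

namespace Quantum

section QuantumSpaces

open scoped ENNReal Matrix.Norms.L2Operator

/-- The two-sided product `α v β` of a matrix `v` over a complex vector space with scalar
matrices: `(α v β) i j = ∑ k l, α i k • β l j • v k l`. -/
def sandwich {E : Type*} [AddCommGroup E] [Module ℂ E] {m n : ℕ}
    (α : Matrix (Fin n) (Fin m) ℂ) (v : Matrix (Fin m) (Fin m) E)
    (β : Matrix (Fin m) (Fin n) ℂ) : Matrix (Fin n) (Fin n) E :=
  Matrix.of fun i j => ∑ k, ∑ l, (α i k * β l j) • v k l

/-- The block-diagonal matrix `v ⊕ w` of size `m + n`. -/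
def blockSum {E : Type*} [AddCommGroup E] {m n : ℕ}
    (v : Matrix (Fin m) (Fin m) E) (w : Matrix (Fin n) (Fin n) E) :
    Matrix (Fin (m + n)) (Fin (m + n)) E :=
  (Matrix.fromBlocks v 0 0 w).submatrix finSumFinEquiv.symm finSumFinEquiv.symm

/-- A sequence of seminorms on the spaces `M_n(E)` satisfying the two axioms of Ruan. Scalar
matrices carry the operator norm between Hilbert spaces `ℂ^m`. (The index `n = 0` is harmless:
`M_0(E) = 0`.) -/
structure QuantumSeminorm (E : Type*) [AddCommGroup E] [Module ℂ E] where
  /-- the seminorm on `M_n(E)` -/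
  seminorm : ∀ n : ℕ, Seminorm ℂ (Matrix (Fin n) (Fin n) E)
  block_eq : ∀ {m n : ℕ} (v : Matrix (Fin m) (Fin m) E) (w : Matrix (Fin n) (Fin n) E),
    seminorm (m + n) (blockSum v w) = max (seminorm m v) (seminorm n w)
  sandwich_le : ∀ {m n : ℕ} (α : Matrix (Fin n) (Fin m) ℂ) (v : Matrix (Fin m) (Fin m) E)
    (β : Matrix (Fin m) (Fin n) ℂ),
    seminorm n (sandwich α v β) ≤ ‖α‖ * seminorm m v * ‖β‖

/-- A quantum space (abstract operator space, not necessarily complete): a complex vector space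
with a quantum norm, i.e. norms on all `M_n(E)` satisfying the axioms of Ruan. -/
class QuantumSpace (E : Type*) [AddCommGroup E] [Module ℂ E] extends QuantumSeminorm E where
  eq_zero_of_seminorm : ∀ (n : ℕ) (v : Matrix (Fin n) (Fin n) E), seminorm n v = 0 → v = 0

/-- The norm of a matrix over a quantum space. -/
noncomputable def mnorm {E : Type*} [AddCommGroup E] [Module ℂ E] [Q : QuantumSpace E] {n : ℕ}
    (v : Matrix (Fin n) (Fin n) E) : ℝ :=
  Q.seminorm n v

/-! ### Operators between quantum spaces -/

section Operators

variable {F E : Type*} [AddCommGroup F] [Module ℂ F] [AddCommGroup E] [Module ℂ E]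

/-- The `n`-amplification `φ_n : M_n(F) → M_n(E)`, applying `φ` to every entry. -/
def amp (φ : F →ₗ[ℂ] E) (n : ℕ) : Matrix (Fin n) (Fin n) F →ₗ[ℂ] Matrix (Fin n) (Fin n) E :=
  φ.mapMatrix

variable [QuantumSpace F] [QuantumSpace E]

/-- The operator norm of the `n`-amplification (possibly `∞`). -/
noncomputable def ampNorm (φ : F →ₗ[ℂ] E) (n : ℕ) : ℝ≥0∞ :=
  ⨆ (v : Matrix (Fin n) (Fin n) F) (_ : mnorm v ≤ 1), ENNReal.ofReal (mnorm (amp φ n v))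

/-- The completely bounded norm `sup_n ‖φ_n‖` (possibly `∞`). -/
noncomputable def cbNorm (φ : F →ₗ[ℂ] E) : ℝ≥0∞ :=
  ⨆ n : ℕ, ampNorm φ n

def CompletelyBounded (φ : F →ₗ[ℂ] E) : Prop :=
  cbNorm φ < ⊤

def CompletelyContractive (φ : F →ₗ[ℂ] E) : Prop :=
  ∀ (n : ℕ) (v : Matrix (Fin n) (Fin n) F), mnorm (amp φ n v) ≤ mnorm v

def CompletelyIsometric (φ : F →ₗ[ℂ] E) : Prop :=
  ∀ (n : ℕ) (v : Matrix (Fin n) (Fin n) F), mnorm (amp φ n v) = mnorm v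

/-- Every amplification maps the closed unit ball onto the closed unit ball. -/
def CompletelyStrictlyCoisometric (φ : F →ₗ[ℂ] E) : Prop :=
  ∀ n : ℕ, amp φ n '' {v | mnorm v ≤ 1} = {w | mnorm w ≤ 1}

end Operators

/-- `P` is metrically projective: completely bounded operators out of `P` lift, with the same
completely bounded norm, along completely strictly coisometric operators. -/
def MetricallyProjective.{v, w} (P : Type w) [AddCommGroup P] [Module ℂ P] [QuantumSpace P] :
    Prop :=
  ∀ (F E : Type v) [AddCommGroup F] [Module ℂ F] [QuantumSpace F]
    [AddCommGroup E] [Module ℂ E] [QuantumSpace E]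
    (τ : F →ₗ[ℂ] E) (φ : P →ₗ[ℂ] E),
    CompletelyStrictlyCoisometric τ → CompletelyBounded φ →
      ∃ ψ : P →ₗ[ℂ] F, CompletelyBounded ψ ∧ τ ∘ₗ ψ = φ ∧ cbNorm ψ = cbNorm φ

section Retracts

variable (P X : Type*) [AddCommGroup P] [Module ℂ P] [QuantumSpace P]
  [AddCommGroup X] [Module ℂ X] [QuantumSpace X]

/-- `P` is a retract of `X` in the category of quantum spaces and completely contractive
operators. -/
def IsRetract : Prop :=
  ∃ (σ : X →ₗ[ℂ] P) (ρ : P →ₗ[ℂ] X),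
    CompletelyContractive σ ∧ CompletelyContractive ρ ∧ σ ∘ₗ ρ = LinearMap.id

/-- `P` is, up to a completely isometric isomorphism, a direct summand of `X` such that the
natural projection onto it has completely bounded norm `1` (for `P = 0` this projection is `0`,
and nothing is asked of its norm). -/
def IsDirectSummand : Prop :=
  ∃ (ι : P →ₗ[ℂ] X) (π : X →ₗ[ℂ] X), CompletelyIsometric ι ∧
    LinearMap.IsProj (LinearMap.range ι) π ∧ (Nontrivial P → cbNorm π = 1)

end Retracts

/-! ### Auxiliary facts: norms of scalar matrices -/

section ScalarMatrices

variable {ι κ ι' κ' : Type*} [Fintype ι] [Fintype κ] [Fintype ι'] [Fintype κ']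
  [DecidableEq κ] [DecidableEq κ']

theorem l2_mulVec_le (A : Matrix ι κ ℂ) (x : κ → ℂ) :
    ∑ i, ‖A.mulVec x i‖ ^ 2 ≤ ‖A‖ ^ 2 * ∑ j, ‖x j‖ ^ 2 := by
  have h := Matrix.l2_opNorm_mulVec A (WithLp.toLp 2 x)
  have h2 := pow_le_pow_left₀ (norm_nonneg _) h 2
  rw [mul_pow, EuclideanSpace.norm_sq_eq, EuclideanSpace.norm_sq_eq] at h2
  simpa using h2

theorem l2_le_of (A : Matrix ι κ ℂ) {C : ℝ} (hC : 0 ≤ C)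
    (h : ∀ x : κ → ℂ, ∑ i, ‖A.mulVec x i‖ ^ 2 ≤ C ^ 2 * ∑ j, ‖x j‖ ^ 2) : ‖A‖ ≤ C := by
  rw [Matrix.l2_opNorm_def]
  refine ContinuousLinearMap.opNorm_le_bound _ hC fun x => ?_
  refine (sq_le_sq₀ (norm_nonneg _) (by positivity)).mp ?_
  rw [mul_pow, EuclideanSpace.norm_sq_eq, EuclideanSpace.norm_sq_eq]
  simpa using h x.ofLp

theorem l2_submatrix_equiv_le (A : Matrix ι κ ℂ) (e : ι' ≃ ι) (f : κ' ≃ κ) :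
    ‖A.submatrix e f‖ ≤ ‖A‖ := by
  refine l2_le_of _ (norm_nonneg _) fun x => ?_
  have h := l2_mulVec_le A (x ∘ f.symm)
  have h1 : ∑ i, ‖(A.submatrix e f).mulVec x i‖ ^ 2
      = ∑ i, ‖A.mulVec (x ∘ f.symm) i‖ ^ 2 := by
    rw [← e.sum_comp]
    refine Finset.sum_congr rfl fun i _ => ?_
    rw [Matrix.submatrix_mulVec_equiv]
    rfl
  have h2 : ∑ j, ‖(x ∘ f.symm) j‖ ^ 2 = ∑ j, ‖x j‖ ^ 2 :=
    f.symm.sum_comp (fun j => ‖x j‖ ^ 2)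
  rw [h1, ← h2]
  exact h

theorem l2_fromBlocks_le (A : Matrix ι κ ℂ) (D : Matrix ι' κ' ℂ) :
    ‖Matrix.fromBlocks A 0 0 D‖ ≤ max ‖A‖ ‖D‖ := by
  refine l2_le_of _ (le_max_of_le_left (norm_nonneg _)) fun x => ?_
  rw [Fintype.sum_sum_type, Fintype.sum_sum_type, Matrix.fromBlocks_mulVec, mul_add]
  simp only [Sum.elim_inl, Sum.elim_inr, Matrix.zero_mulVec, add_zero, zero_add]
  refine add_le_add ((l2_mulVec_le A _).trans ?_) ((l2_mulVec_le D _).trans ?_)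
  · refine mul_le_mul_of_nonneg_right ?_ (by positivity)
    exact pow_le_pow_left₀ (norm_nonneg _) (le_max_left _ _) 2
  · refine mul_le_mul_of_nonneg_right ?_ (by positivity)
    exact pow_le_pow_left₀ (norm_nonneg _) (le_max_right _ _) 2

/-- `α ⊗ 1`. -/
def tensorOne (α : Matrix ι κ ℂ) (μ : Type*) [DecidableEq μ] : Matrix (ι × μ) (κ × μ) ℂ :=
  Matrix.of fun p q => if p.2 = q.2 then α p.1 q.1 else 0

/-- `1 ⊗ α`. -/
def oneTensor (α : Matrix ι κ ℂ) (μ : Type*) [DecidableEq μ] : Matrix (μ × ι) (μ × κ) ℂ :=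
  Matrix.of fun p q => if p.1 = q.1 then α p.2 q.2 else 0

theorem l2_tensorOne_le (α : Matrix ι κ ℂ) (μ : Type*) [DecidableEq μ] [Fintype μ] :
    ‖tensorOne α μ‖ ≤ ‖α‖ := by
  refine l2_le_of _ (norm_nonneg _) fun x => ?_
  have h : ∀ p : ι × μ, (tensorOne α μ).mulVec x p = α.mulVec (fun j => x (j, p.2)) p.1 := by
    intro p
    simp [tensorOne, Matrix.mulVec, dotProduct, Fintype.sum_prod_type]
  simp only [h]
  rw [Fintype.sum_prod_type_right, Fintype.sum_prod_type_right, Finset.mul_sum]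
  exact Finset.sum_le_sum fun c _ => l2_mulVec_le α fun j => x (j, c)

theorem l2_oneTensor_le (α : Matrix ι κ ℂ) (μ : Type*) [DecidableEq μ] [Fintype μ] :
    ‖oneTensor α μ‖ ≤ ‖α‖ :=
  (l2_submatrix_equiv_le (tensorOne α μ) (Equiv.prodComm _ _) (Equiv.prodComm _ _)).trans
    (l2_tensorOne_le α μ)

theorem l2_sandwich_le {ν : Type*} [Fintype ν] [DecidableEq ν] [DecidableEq ι]
    {A : Matrix ι κ ℂ} {B : Matrix κ κ' ℂ} {C : Matrix κ' ν ℂ} {a b c : ℝ}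
    (hA : ‖A‖ ≤ a) (hB : ‖B‖ ≤ b) (hC : ‖C‖ ≤ c) : ‖A * B * C‖ ≤ a * b * c := by
  have ha := (norm_nonneg _).trans hA
  have hb := (norm_nonneg _).trans hB
  calc ‖A * B * C‖ ≤ ‖A * B‖ * ‖C‖ := Matrix.l2_opNorm_mul _ _
    _ ≤ (‖A‖ * ‖B‖) * ‖C‖ := by gcongr; exact Matrix.l2_opNorm_mul _ _
    _ ≤ a * b * c := by gcongr

end ScalarMatrices

/-! ### Auxiliary facts: constructing quantum seminorms, completely bounded norms -/

/-- In Ruan's first axiom the inequality `≤` suffices. -/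
noncomputable def QuantumSeminorm.ofLE {E : Type*} [AddCommGroup E] [Module ℂ E]
    (p : ∀ n : ℕ, Seminorm ℂ (Matrix (Fin n) (Fin n) E))
    (h1 : ∀ {m n : ℕ} (v : Matrix (Fin m) (Fin m) E) (w : Matrix (Fin n) (Fin n) E),
      p (m + n) (blockSum v w) ≤ max (p m v) (p n w))
    (h2 : ∀ {m n : ℕ} (α : Matrix (Fin n) (Fin m) ℂ) (v : Matrix (Fin m) (Fin m) E)
      (β : Matrix (Fin m) (Fin n) ℂ), p n (sandwich α v β) ≤ ‖α‖ * p m v * ‖β‖) :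
    QuantumSeminorm E where
  seminorm := p
  sandwich_le := h2
  block_eq := by
    intro m n v w
    have key : ∀ {k : ℕ} (f : Fin k → Fin (m + n)) (_ : Function.Injective f)
        (x : Matrix (Fin k) (Fin k) E) (_ : (blockSum v w).submatrix f f = x),
        p k x ≤ p (m + n) (blockSum v w) := by
      intro k f hf x hx
      have hs : sandwich (Matrix.of fun i j => if f i = j then (1 : ℂ) else 0) (blockSum v w)
          (Matrix.of fun i j => if i = f j then (1 : ℂ) else 0) = x := by
        ext i j
        simp [sandwich, ← hx]
      have hα : ‖(Matrix.of fun i j => if f i = j then (1 : ℂ) else 0 :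
          Matrix (Fin k) (Fin (m + n)) ℂ)‖ ≤ 1 := by
        refine l2_le_of _ zero_le_one fun x => ?_
        simp only [Matrix.mulVec, dotProduct, Matrix.of_apply, ite_mul, one_mul, zero_mul,
          Finset.sum_ite_eq, Finset.mem_univ, if_true, one_pow]
        calc ∑ i, ‖x (f i)‖ ^ 2 = ∑ j ∈ Finset.univ.map ⟨f, hf⟩, ‖x j‖ ^ 2 := by simp
          _ ≤ ∑ j, ‖x j‖ ^ 2 :=
            Finset.sum_le_sum_of_subset_of_nonneg (Finset.subset_univ _)
              fun _ _ _ => by positivity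
      have hβ : ‖(Matrix.of fun i j => if i = f j then (1 : ℂ) else 0 :
          Matrix (Fin (m + n)) (Fin k) ℂ)‖ ≤ 1 := by
        rw [← Matrix.l2_opNorm_conjTranspose]
        refine le_trans (le_of_eq ?_) hα
        congr 1
        ext i j
        by_cases h : f i = j <;> simp [h, eq_comm]
      rw [← hs]
      refine (h2 _ _ _).trans ?_
      have h0 := apply_nonneg (p (m + n)) (blockSum v w)
      calc _ ≤ 1 * p (m + n) (blockSum v w) * 1 := by gcongr
        _ = _ := by ring
    refine le_antisymm (h1 v w) (max_le ?_ ?_)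
    · refine key (Fin.castAdd n) (Fin.castAdd_injective m n) v ?_
      ext i j
      simp [blockSum]
    · refine key (Fin.natAdd m) (Fin.natAdd_injective n m) w ?_
      ext i j
      simp [blockSum]

section CB

variable {F E : Type*} [AddCommGroup F] [Module ℂ F] [AddCommGroup E] [Module ℂ E]
  [QuantumSpace F] [QuantumSpace E]

theorem mnorm_nonneg {n : ℕ} (v : Matrix (Fin n) (Fin n) F) : 0 ≤ mnorm v :=
  apply_nonneg _ _

theorem mnorm_smul {n : ℕ} (r : ℂ) (v : Matrix (Fin n) (Fin n) F) :
    mnorm (r • v) = ‖r‖ * mnorm v :=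
  map_smul_eq_mul (QuantumSpace.toQuantumSeminorm.seminorm n) r v

theorem mnorm_add_le {n : ℕ} (v w : Matrix (Fin n) (Fin n) F) :
    mnorm (v + w) ≤ mnorm v + mnorm w :=
  map_add_le_add (QuantumSpace.toQuantumSeminorm.seminorm n) v w

theorem cbNorm_le {φ : F →ₗ[ℂ] E} {C : ℝ} (hC : 0 ≤ C)
    (h : ∀ (n : ℕ) (v : Matrix (Fin n) (Fin n) F), mnorm (amp φ n v) ≤ C * mnorm v) :
    cbNorm φ ≤ ENNReal.ofReal C := by
  refine iSup_le fun n => iSup_le fun v => iSup_le fun hv => ENNReal.ofReal_le_ofReal ?_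
  exact (h n v).trans (mul_le_of_le_one_right hC hv)

theorem mnorm_amp_le {φ : F →ₗ[ℂ] E} (hφ : CompletelyBounded φ) {n : ℕ}
    (v : Matrix (Fin n) (Fin n) F) : mnorm (amp φ n v) ≤ (cbNorm φ).toReal * mnorm v := by
  have hball : ∀ w : Matrix (Fin n) (Fin n) F, mnorm w ≤ 1 →
      mnorm (amp φ n w) ≤ (cbNorm φ).toReal := by
    intro w hw
    refine (ENNReal.ofReal_le_iff_le_toReal hφ.ne).mp ?_
    exact (le_iSup₂ (f := fun (v : Matrix (Fin n) (Fin n) F) (_ : mnorm v ≤ 1) =>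
      ENNReal.ofReal (mnorm (amp φ n v))) w hw).trans (le_iSup (fun n => ampNorm φ n) n)
  rcases (mnorm_nonneg v).eq_or_lt with h0 | hpos
  · have hv : v = 0 := QuantumSpace.eq_zero_of_seminorm n v h0.symm
    subst hv
    rw [← h0, map_zero, mul_zero]
    exact (map_zero (QuantumSpace.toQuantumSeminorm.seminorm n)).le
  · have hr : ‖(((mnorm v)⁻¹ : ℝ) : ℂ)‖ = (mnorm v)⁻¹ := by
      rw [Complex.norm_real, Real.norm_of_nonneg (inv_nonneg.mpr hpos.le)]
    have h1 := hball ((((mnorm v)⁻¹ : ℝ) : ℂ) • v) (by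
      rw [mnorm_smul, hr, inv_mul_cancel₀ hpos.ne'])
    rw [map_smul, mnorm_smul, hr, inv_mul_le_iff₀ hpos] at h1
    rwa [mul_comm]

end CB

/-! ### The spaces `M_n = B(ℂ^n)` and `N_n` -/

/-- `B(ℂ^n)`. -/
def MatOp (n : ℕ) : Type := Matrix (Fin n) (Fin n) ℂ

noncomputable instance (n : ℕ) : AddCommGroup (MatOp n) :=
  inferInstanceAs (AddCommGroup (Matrix (Fin n) (Fin n) ℂ))

noncomputable instance (n : ℕ) : Module ℂ (MatOp n) :=
  inferInstanceAs (Module ℂ (Matrix (Fin n) (Fin n) ℂ))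

/-- An element of `B(ℂ^n)` as a matrix. -/
noncomputable def MatOp.toMatrix (n : ℕ) : MatOp n ≃ₗ[ℂ] Matrix (Fin n) (Fin n) ℂ :=
  LinearEquiv.refl ℂ (Matrix (Fin n) (Fin n) ℂ)

/-- The identification of `M_k(B(ℂ^n))` with the operators on `(ℂ^n)^k`. -/
noncomputable def flatten {k n : ℕ} (v : Matrix (Fin k) (Fin k) (MatOp n)) :
    Matrix (Fin k × Fin n) (Fin k × Fin n) ℂ :=
  Matrix.comp (Fin k) (Fin k) (Fin n) (Fin n) ℂ (v.map (MatOp.toMatrix n))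

theorem flatten_apply {k n : ℕ} (v : Matrix (Fin k) (Fin k) (MatOp n)) (p q : Fin k × Fin n) :
    flatten v p q = MatOp.toMatrix n (v p.1 q.1) p.2 q.2 :=
  rfl

theorem blockSum_apply {E : Type*} [AddCommGroup E] {m n : ℕ}
    (v : Matrix (Fin m) (Fin m) E) (w : Matrix (Fin n) (Fin n) E) (x y : Fin m ⊕ Fin n) :
    blockSum v w (finSumFinEquiv x) (finSumFinEquiv y) = Matrix.fromBlocks v 0 0 w x y := by
  simp only [blockSum, Matrix.submatrix_apply, Equiv.symm_apply_apply]

theorem flatten_sandwich {k m n : ℕ} (α : Matrix (Fin k) (Fin m) ℂ)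
    (v : Matrix (Fin m) (Fin m) (MatOp n)) (β : Matrix (Fin m) (Fin k) ℂ) :
    flatten (sandwich α v β) = tensorOne α (Fin n) * flatten v * tensorOne β (Fin n) := by
  ext ⟨i, a⟩ ⟨l, d⟩
  have h : flatten (sandwich α v β) (i, a) (l, d)
      = ∑ j, ∑ k, (α i j * β k l) * flatten v (j, a) (k, d) := by
    simp only [flatten_apply, sandwich, Matrix.of_apply, map_sum, map_smul, Matrix.sum_apply,
      Matrix.smul_apply, smul_eq_mul]
  rw [h]
  simp only [Matrix.mul_apply, tensorOne, Matrix.of_apply, Fintype.sum_prod_type, ite_mul,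
    zero_mul, mul_ite, mul_zero, Finset.sum_ite_eq, Finset.mem_univ, if_true,
    Finset.sum_ite_eq', Finset.sum_mul]
  rw [Finset.sum_comm]
  refine Finset.sum_congr rfl fun k _ => Finset.sum_congr rfl fun j _ => ?_
  ring

theorem flatten_blockSum_le {k m n : ℕ} (v : Matrix (Fin k) (Fin k) (MatOp n))
    (w : Matrix (Fin m) (Fin m) (MatOp n)) :
    ‖flatten (blockSum v w)‖ ≤ max ‖flatten v‖ ‖flatten w‖ := by
  refine le_trans (le_trans (le_of_eq ?_) (l2_submatrix_equiv_le
    (Matrix.fromBlocks (flatten v) 0 0 (flatten w))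
    (((finSumFinEquiv.symm.prodCongr (Equiv.refl (Fin n))).trans
      (Equiv.sumProdDistrib (Fin k) (Fin m) (Fin n))))
    (((finSumFinEquiv.symm.prodCongr (Equiv.refl (Fin n))).trans
      (Equiv.sumProdDistrib (Fin k) (Fin m) (Fin n)))))) (l2_fromBlocks_le _ _)
  congr 1
  ext ⟨i, a⟩ ⟨j, b⟩
  obtain ⟨i, rfl⟩ := finSumFinEquiv.surjective i
  obtain ⟨j, rfl⟩ := finSumFinEquiv.surjective j
  rcases i with i | i <;> rcases j with j | j <;>
    simp [-finSumFinEquiv_apply_left, -finSumFinEquiv_apply_right, flatten_apply, blockSum_apply]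

/-- `M_n = B(ℂ^n)` with its standard quantum norm: the norm of a matrix in `M_k(B(ℂ^n))` is its
operator norm on `(ℂ^n)^k`. -/
noncomputable instance (n : ℕ) : QuantumSpace (MatOp n) where
  toQuantumSeminorm := QuantumSeminorm.ofLE
    (fun k => Seminorm.of (fun v => ‖flatten v‖)
      (fun v w => norm_add_le (flatten v) (flatten w))
      (fun r v => norm_smul r (flatten v)))
    (fun v w => flatten_blockSum_le v w)
    (fun α v β => by
      change ‖flatten (sandwich α v β)‖ ≤ ‖α‖ * ‖flatten v‖ * ‖β‖
      rw [flatten_sandwich]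
      exact l2_sandwich_le (l2_tensorOne_le _ _) le_rfl (l2_tensorOne_le _ _))
  eq_zero_of_seminorm := fun k v h => by
    have h' : flatten v = 0 := norm_eq_zero.mp h
    ext i j
    refine (MatOp.toMatrix n).injective ?_
    ext a b
    exact congrFun (congrFun h' (i, a)) (j, b)

theorem mnorm_matOp {k n : ℕ} (v : Matrix (Fin k) (Fin k) (MatOp n)) :
    mnorm v = ‖flatten v‖ :=
  rfl

/-- `N_n`, the nuclear (trace class) operators on `ℂ^n`. -/
def Nuc (n : ℕ) : Type := Matrix (Fin n) (Fin n) ℂ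

noncomputable instance (n : ℕ) : AddCommGroup (Nuc n) :=
  inferInstanceAs (AddCommGroup (Matrix (Fin n) (Fin n) ℂ))

noncomputable instance (n : ℕ) : Module ℂ (Nuc n) :=
  inferInstanceAs (Module ℂ (Matrix (Fin n) (Fin n) ℂ))

/-- An element of `N_n` as a matrix. -/
noncomputable def Nuc.toMatrix (n : ℕ) : Nuc n ≃ₗ[ℂ] Matrix (Fin n) (Fin n) ℂ :=
  LinearEquiv.refl ℂ (Matrix (Fin n) (Fin n) ℂ)

/-- The trace pairing `tr (b a)` of `b ∈ N_n` and `a ∈ B(ℂ^n)`. -/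
noncomputable def tracePairing (n : ℕ) : Nuc n →ₗ[ℂ] MatOp n →ₗ[ℂ] ℂ :=
  LinearMap.mk₂ ℂ (fun b a => Matrix.trace (Nuc.toMatrix n b * MatOp.toMatrix n a))
    (fun b b' a => by rw [map_add, add_mul, Matrix.trace_add])
    (fun c b a => by rw [map_smul, Matrix.smul_mul, Matrix.trace_smul])
    (fun b a a' => by rw [map_add, mul_add, Matrix.trace_add])
    (fun c b a => by rw [map_smul, Matrix.mul_smul, Matrix.trace_smul])

/-- A matrix `w ∈ M_k(N_n)` as the operator `B(ℂ^n) → M_k`, `a ↦ [tr (w i j a)]`. -/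
noncomputable def dualOp {k n : ℕ} (w : Matrix (Fin k) (Fin k) (Nuc n)) :
    MatOp n →ₗ[ℂ] MatOp k where
  toFun a := (MatOp.toMatrix k).symm (Matrix.of fun i j => tracePairing n (w i j) a)
  map_add' a b := by
    rw [← map_add]
    congr 1
    ext i j
    simp
  map_smul' c a := by
    rw [RingHom.id_apply, ← map_smul]
    congr 1
    ext i j
    simp

theorem dualOp_apply {k n : ℕ} (w : Matrix (Fin k) (Fin k) (Nuc n)) (a : MatOp n)
    (i j : Fin k) :
    MatOp.toMatrix k (dualOp w a) i j = tracePairing n (w i j) a :=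
  rfl

theorem flatten_amp_dualOp {k m n : ℕ} (w : Matrix (Fin k) (Fin k) (Nuc n))
    (v : Matrix (Fin m) (Fin m) (MatOp n)) (p q : Fin m) (i j : Fin k) :
    flatten (amp (dualOp w) m v) (p, i) (q, j) = tracePairing n (w i j) (v p q) :=
  rfl

theorem dualOp_completelyBounded {k n : ℕ} (w : Matrix (Fin k) (Fin k) (Nuc n)) :
    CompletelyBounded (dualOp w) := by
  let W : Fin k → Fin k → Matrix (Fin n) (Fin n) ℂ := fun i j => Nuc.toMatrix n (w i j)
  let R : Fin k → Fin n → Matrix (Fin k) (Fin n) ℂ := fun i t => Matrix.single i t 1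
  let L : Fin n → Fin k → Matrix (Fin n) (Fin k) ℂ := fun s j => Matrix.single s j 1
  refine (cbNorm_le (C := ∑ i, ∑ j, ∑ s, ∑ t, ‖W i j s t‖ * (‖R i t‖ * ‖L s j‖))
    (by positivity) fun m v => ?_).trans_lt ENNReal.ofReal_lt_top
  have key : flatten (amp (dualOp w) m v) = ∑ i, ∑ j, ∑ s, ∑ t,
      W i j s t • (oneTensor (R i t) (Fin m) * flatten v * oneTensor (L s j) (Fin m)) := by
    ext ⟨p, i'⟩ ⟨q, j'⟩
    rw [flatten_amp_dualOp]
    have h1 : ∀ i j s t,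
        (oneTensor (R i t) (Fin m) * flatten v * oneTensor (L s j) (Fin m)) (p, i') (q, j')
          = if i = i' ∧ j = j' then flatten v (p, t) (q, s) else 0 := by
      intro i j s t
      simp only [Matrix.mul_apply, oneTensor, Matrix.of_apply, Fintype.sum_prod_type, R, L,
        Matrix.single_apply]
      by_cases hi : i = i' <;> by_cases hj : j = j' <;>
        simp [hi, hj, Finset.sum_ite_eq]
    have h2 : tracePairing n (w i' j') (v p q) = ∑ s, ∑ t, W i' j' s t * flatten v (p, t) (q, s) :=
      rfl
    simp only [Matrix.sum_apply, Matrix.smul_apply, h1, smul_eq_mul, mul_ite, mul_zero]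
    rw [h2, Finset.sum_eq_single i', Finset.sum_eq_single j']
    · simp
    · intro j _ hj
      simp [hj]
    · simp
    · intro i _ hi
      simp [hi]
    · simp
  rw [mnorm_matOp, mnorm_matOp, key]
  simp only [Finset.sum_mul]
  refine norm_sum_le_of_le _ fun i _ => norm_sum_le_of_le _ fun j _ =>
    norm_sum_le_of_le _ fun s _ => norm_sum_le_of_le _ fun t _ => ?_
  rw [norm_smul]
  refine (mul_le_mul_of_nonneg_left (l2_sandwich_le (l2_oneTensor_le (R i t) (Fin m)) le_rfl
    (l2_oneTensor_le (L s j) (Fin m))) (norm_nonneg _)).trans (le_of_eq ?_)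
  ring

/-- The quantum norm of `N_n` is bounded by `C` as soon as the associated operator is. -/
theorem toReal_cbNorm_dualOp_le {k n : ℕ} (w : Matrix (Fin k) (Fin k) (Nuc n)) {C : ℝ}
    (hC : 0 ≤ C) (h : ∀ (m : ℕ) (v : Matrix (Fin m) (Fin m) (MatOp n)),
      ‖flatten (amp (dualOp w) m v)‖ ≤ C * ‖flatten v‖) : (cbNorm (dualOp w)).toReal ≤ C :=
  ENNReal.toReal_le_of_le_ofReal hC (cbNorm_le hC h)

theorem flatten_amp_dualOp_le {k m n : ℕ} (w : Matrix (Fin k) (Fin k) (Nuc n))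
    (v : Matrix (Fin m) (Fin m) (MatOp n)) :
    ‖flatten (amp (dualOp w) m v)‖ ≤ (cbNorm (dualOp w)).toReal * ‖flatten v‖ :=
  mnorm_amp_le (dualOp_completelyBounded w) v

theorem dualOp_add {k n : ℕ} (w w' : Matrix (Fin k) (Fin k) (Nuc n)) :
    dualOp (w + w') = dualOp w + dualOp w' := by
  refine LinearMap.ext fun a => ?_
  funext i j
  exact LinearMap.congr_fun (map_add (tracePairing n) (w i j) (w' i j)) a

theorem dualOp_smul {k n : ℕ} (r : ℂ) (w : Matrix (Fin k) (Fin k) (Nuc n)) :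
    dualOp (r • w) = r • dualOp w := by
  refine LinearMap.ext fun a => ?_
  funext i j
  exact LinearMap.congr_fun (map_smul (tracePairing n) r (w i j)) a

theorem cbNorm_dualOp_add_le {k n : ℕ} (w w' : Matrix (Fin k) (Fin k) (Nuc n)) :
    (cbNorm (dualOp (w + w'))).toReal
      ≤ (cbNorm (dualOp w)).toReal + (cbNorm (dualOp w')).toReal := by
  refine toReal_cbNorm_dualOp_le _ (by positivity) fun m v => ?_
  have h : flatten (amp (dualOp (w + w')) m v)
      = flatten (amp (dualOp w) m v) + flatten (amp (dualOp w') m v) := by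
    rw [dualOp_add]
    rfl
  rw [h, add_mul]
  exact (norm_add_le _ _).trans
    (add_le_add (flatten_amp_dualOp_le w v) (flatten_amp_dualOp_le w' v))

theorem cbNorm_dualOp_smul_le {k n : ℕ} (r : ℂ) (w : Matrix (Fin k) (Fin k) (Nuc n)) :
    (cbNorm (dualOp (r • w))).toReal ≤ ‖r‖ * (cbNorm (dualOp w)).toReal := by
  refine toReal_cbNorm_dualOp_le _ (by positivity) fun m v => ?_
  have h : flatten (amp (dualOp (r • w)) m v) = r • flatten (amp (dualOp w) m v) := by
    rw [dualOp_smul]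
    rfl
  rw [h, norm_smul, mul_assoc]
  exact mul_le_mul_of_nonneg_left (flatten_amp_dualOp_le w v) (norm_nonneg _)

theorem cbNorm_dualOp_blockSum_le {k l n : ℕ} (w : Matrix (Fin k) (Fin k) (Nuc n))
    (w' : Matrix (Fin l) (Fin l) (Nuc n)) :
    (cbNorm (dualOp (blockSum w w'))).toReal
      ≤ max (cbNorm (dualOp w)).toReal (cbNorm (dualOp w')).toReal := by
  refine toReal_cbNorm_dualOp_le _ (le_max_of_le_left ENNReal.toReal_nonneg) fun m v => ?_
  refine le_trans (le_trans (le_of_eq ?_) (l2_submatrix_equiv_le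
    (Matrix.fromBlocks (flatten (amp (dualOp w) m v)) 0 0 (flatten (amp (dualOp w') m v)))
    (((Equiv.refl (Fin m)).prodCongr finSumFinEquiv.symm).trans
      (Equiv.prodSumDistrib (Fin m) (Fin k) (Fin l)))
    (((Equiv.refl (Fin m)).prodCongr finSumFinEquiv.symm).trans
      (Equiv.prodSumDistrib (Fin m) (Fin k) (Fin l))))) ((l2_fromBlocks_le _ _).trans ?_)
  · congr 1
    ext ⟨p, i⟩ ⟨q, j⟩
    obtain ⟨i, rfl⟩ := finSumFinEquiv.surjective i
    obtain ⟨j, rfl⟩ := finSumFinEquiv.surjective j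
    rcases i with i | i <;> rcases j with j | j <;>
      simp [-finSumFinEquiv_apply_left, -finSumFinEquiv_apply_right, flatten_amp_dualOp,
        blockSum_apply]
  · rw [max_mul_of_nonneg _ _ (norm_nonneg _)]
    exact max_le_max (flatten_amp_dualOp_le w v) (flatten_amp_dualOp_le w' v)

theorem cbNorm_dualOp_sandwich_le {k l n : ℕ} (α : Matrix (Fin l) (Fin k) ℂ)
    (w : Matrix (Fin k) (Fin k) (Nuc n)) (β : Matrix (Fin k) (Fin l) ℂ) :
    (cbNorm (dualOp (sandwich α w β))).toReal
      ≤ ‖α‖ * (cbNorm (dualOp w)).toReal * ‖β‖ := by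
  refine toReal_cbNorm_dualOp_le _ (by positivity) fun m v => ?_
  have h : flatten (amp (dualOp (sandwich α w β)) m v)
      = oneTensor α (Fin m) * flatten (amp (dualOp w) m v) * oneTensor β (Fin m) := by
    ext ⟨p, i⟩ ⟨q, j⟩
    simp only [Matrix.mul_apply, oneTensor, Matrix.of_apply, Fintype.sum_prod_type, ite_mul,
      zero_mul, mul_ite, mul_zero, Finset.sum_mul, flatten_amp_dualOp, sandwich, map_sum,
      map_smul, LinearMap.sum_apply, LinearMap.smul_apply, smul_eq_mul]
    simp [Finset.sum_ite_irrel]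
    rw [Finset.sum_comm]
    refine Finset.sum_congr rfl fun s _ => Finset.sum_congr rfl fun t _ => ?_
    ring
  rw [h]
  refine (l2_sandwich_le (l2_oneTensor_le α _) (flatten_amp_dualOp_le w v)
    (l2_oneTensor_le β _)).trans (le_of_eq ?_)
  ring

/-- `N_n` with the trace quantum norm, i.e. as the quantum dual of `B(ℂ^n)`: a matrix
`w ∈ M_k(N_n)` has the completely bounded norm of the operator `B(ℂ^n) → M_k`,
`a ↦ [tr (w i j a)]`. -/
noncomputable instance (n : ℕ) : QuantumSpace (Nuc n) where
  toQuantumSeminorm := QuantumSeminorm.ofLE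
    (fun k => Seminorm.ofSMulLE (fun w => (cbNorm (dualOp w)).toReal)
      (le_antisymm (toReal_cbNorm_dualOp_le _ le_rfl fun m v => by
        have h : flatten (amp (dualOp (0 : Matrix (Fin k) (Fin k) (Nuc n))) m v) = 0 := by
          ext ⟨p, i⟩ ⟨q, j⟩
          simp [flatten_amp_dualOp]
        rw [h, norm_zero, zero_mul]) ENNReal.toReal_nonneg)
      cbNorm_dualOp_add_le cbNorm_dualOp_smul_le)
    cbNorm_dualOp_blockSum_le cbNorm_dualOp_sandwich_le
  eq_zero_of_seminorm := fun k w h => by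
    have h' : (cbNorm (dualOp w)).toReal = 0 := h
    ext i j
    refine (Nuc.toMatrix n).injective ?_
    rw [Matrix.zero_apply, map_zero]
    refine Matrix.ext_iff_trace_mul_right.mpr fun a => ?_
    have h1 := flatten_amp_dualOp_le w
      (Matrix.of fun _ _ : Fin 1 => (MatOp.toMatrix n).symm a)
    rw [h', zero_mul] at h1
    have h2 := norm_eq_zero.mp (le_antisymm h1 (norm_nonneg _))
    rw [zero_mul, Matrix.trace_zero]
    exact congrFun (congrFun h2 (0, i)) (0, j)

/-! ### The `ℓ₁`-sum of quantum spaces (coproduct for completely contractive operators) -/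

theorem amp_sandwich {F E : Type*} [AddCommGroup F] [Module ℂ F] [AddCommGroup E] [Module ℂ E]
    (φ : F →ₗ[ℂ] E) {m n : ℕ} (α : Matrix (Fin n) (Fin m) ℂ) (v : Matrix (Fin m) (Fin m) F)
    (β : Matrix (Fin m) (Fin n) ℂ) : amp φ n (sandwich α v β) = sandwich α (amp φ m v) β := by
  ext i j
  simp [amp, sandwich]

theorem amp_blockSum {F E : Type*} [AddCommGroup F] [Module ℂ F] [AddCommGroup E] [Module ℂ E]
    (φ : F →ₗ[ℂ] E) {m n : ℕ} (v : Matrix (Fin m) (Fin m) F) (w : Matrix (Fin n) (Fin n) F) :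
    amp φ (m + n) (blockSum v w) = blockSum (amp φ m v) (amp φ n w) := by
  ext i j
  obtain ⟨i, rfl⟩ := finSumFinEquiv.surjective i
  obtain ⟨j, rfl⟩ := finSumFinEquiv.surjective j
  have h : ∀ (a b : Fin (m + n)), amp φ (m + n) (blockSum v w) a b = φ (blockSum v w a b) :=
    fun _ _ => rfl
  rw [h, blockSum_apply, blockSum_apply]
  rcases i with i | i <;> rcases j with j | j <;> simp [amp]

/-- The pull-back of a quantum seminorm along a linear operator. -/
noncomputable def QuantumSeminorm.comap {F E : Type*} [AddCommGroup F] [Module ℂ F]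
    [AddCommGroup E] [Module ℂ E] (φ : F →ₗ[ℂ] E) (p : QuantumSeminorm E) :
    QuantumSeminorm F where
  seminorm n := (p.seminorm n).comp (amp φ n)
  block_eq v w := by
    simp only [Seminorm.comp_apply, amp_blockSum, p.block_eq]
  sandwich_le α v β := by
    simp only [Seminorm.comp_apply, amp_sandwich]
    exact p.sandwich_le α _ β

section L1Sum

variable {Λ : Type*} (E : Λ → Type*) [∀ ν, AddCommGroup (E ν)] [∀ ν, Module ℂ (E ν)]

/-- The algebraic direct sum of the spaces `E ν`, underlying their `ℓ₁`-sum. -/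
def L1Sum : Type _ := DirectSum Λ E

noncomputable instance : AddCommGroup (L1Sum E) := inferInstanceAs (AddCommGroup (DirectSum Λ E))

noncomputable instance : Module ℂ (L1Sum E) := inferInstanceAs (Module ℂ (DirectSum Λ E))

namespace L1Sum

open Classical in
/-- The natural embedding of a summand. -/
noncomputable def inj (ν : Λ) : E ν →ₗ[ℂ] L1Sum E := DirectSum.lof ℂ Λ E ν

/-- The natural projection onto a summand. -/
noncomputable def proj (ν : Λ) : L1Sum E →ₗ[ℂ] E ν := DirectSum.component ℂ Λ E ν

theorem proj_comp_inj_self (ν : Λ) : proj E ν ∘ₗ inj E ν = LinearMap.id := by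
  classical
  exact LinearMap.ext fun x => DirectSum.component.lof_self ℂ ν x

theorem proj_comp_inj_of_ne {μ ν : Λ} (h : ν ≠ μ) : proj E μ ∘ₗ inj E ν = 0 := by
  classical
  refine LinearMap.ext fun x => ?_
  exact (DirectSum.component.of ℂ μ ν x).trans (dif_neg h)

theorem induction {motive : L1Sum E → Prop} (zero : motive 0)
    (inj : ∀ ν x, motive (inj E ν x)) (add : ∀ x y, motive x → motive y → motive (x + y))
    (x : L1Sum E) : motive x := by
  classical
  exact DirectSum.induction_on x zero inj add

variable [∀ ν, QuantumSpace (E ν)]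

/-- The quantum seminorms on `⊕ E ν` for which all natural embeddings of the summands are
completely contractive. -/
def Admissible (p : QuantumSeminorm (L1Sum E)) : Prop :=
  ∀ (ν : Λ) (n : ℕ) (v : Matrix (Fin n) (Fin n) (E ν)),
    p.seminorm n (amp (inj E ν) n v) ≤ mnorm v

theorem exists_bound (n : ℕ) (u : Matrix (Fin n) (Fin n) (L1Sum E)) :
    ∃ C : ℝ, 0 ≤ C ∧ ∀ p, Admissible E p → p.seminorm n u ≤ C := by
  have hadd : ∀ u v : Matrix (Fin n) (Fin n) (L1Sum E),
      (∃ C : ℝ, 0 ≤ C ∧ ∀ p, Admissible E p → p.seminorm n u ≤ C) →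
      (∃ C : ℝ, 0 ≤ C ∧ ∀ p, Admissible E p → p.seminorm n v ≤ C) →
      ∃ C : ℝ, 0 ≤ C ∧ ∀ p, Admissible E p → p.seminorm n (u + v) ≤ C := by
    rintro u v ⟨C, hC, h⟩ ⟨D, hD, k⟩
    exact ⟨C + D, add_nonneg hC hD, fun p hp =>
      (map_add_le_add _ _ _).trans (add_le_add (h p hp) (k p hp))⟩
  have hzero : ∃ C : ℝ, 0 ≤ C ∧ ∀ p, Admissible E p →
      p.seminorm n (0 : Matrix (Fin n) (Fin n) (L1Sum E)) ≤ C :=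
    ⟨0, le_rfl, fun p _ => (map_zero _).le⟩
  rw [Matrix.matrix_eq_sum_single u]
  refine Finset.sum_induction _ _ hadd hzero fun i _ =>
    Finset.sum_induction _ _ hadd hzero fun j _ => ?_
  induction u i j using L1Sum.induction with
  | zero => simpa using hzero
  | add x y hx hy => rw [Matrix.single_add]; exact hadd _ _ hx hy
  | inj ν x =>
    refine ⟨mnorm (Matrix.single i j x), mnorm_nonneg _, fun p hp => ?_⟩
    have h := hp ν n (Matrix.single i j x)
    have h2 : amp (inj E ν) n (Matrix.single i j x) = Matrix.single i j (inj E ν x) := by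
      simp [amp]
    rwa [h2] at h

theorem bddAbove (n : ℕ) (u : Matrix (Fin n) (Fin n) (L1Sum E)) :
    BddAbove (Set.range fun p : {p // Admissible E p} => p.1.seminorm n u) := by
  obtain ⟨C, -, h⟩ := exists_bound E n u
  exact ⟨C, by rintro _ ⟨p, rfl⟩; exact h p.1 p.2⟩

theorem admissible_comap {Y : Type*} [AddCommGroup Y] [Module ℂ Y] [Q : QuantumSpace Y]
    (ψ : L1Sum E →ₗ[ℂ] Y) (h : ∀ ν, CompletelyContractive (ψ ∘ₗ inj E ν)) :
    Admissible E (Q.toQuantumSeminorm.comap ψ) :=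
  fun ν n v => h ν n v

theorem admissible_proj (μ : Λ) :
    Admissible E ((QuantumSpace.toQuantumSeminorm (E := E μ)).comap (proj E μ)) := by
  refine admissible_comap E _ fun ν n v => ?_
  by_cases h : ν = μ
  · subst h
    rw [proj_comp_inj_self]
    exact le_rfl
  · rw [proj_comp_inj_of_ne E h]
    have h0 : amp (0 : E ν →ₗ[ℂ] E μ) n v = 0 := by
      ext i j
      simp [amp]
    rw [h0]
    exact (map_zero (QuantumSpace.toQuantumSeminorm.seminorm n)).le.trans (mnorm_nonneg v)

instance : Nonempty {p // Admissible E p} :=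
  ⟨⟨(⟨fun _ => 0, by simp, by simp⟩ : QuantumSeminorm (L1Sum E)), fun _ _ v => mnorm_nonneg v⟩⟩

/-- The (non-completed) quantum `ℓ₁`-sum: the algebraic direct sum with the largest quantum norm
for which all natural embeddings of the summands are completely contractive. -/
noncomputable instance : QuantumSpace (L1Sum E) where
  toQuantumSeminorm := QuantumSeminorm.ofLE
    (fun n => Seminorm.of (fun u => ⨆ p : {p // Admissible E p}, p.1.seminorm n u)
      (fun u v => ciSup_le fun p => (map_add_le_add _ _ _).trans
        (add_le_add (le_ciSup (bddAbove E n u) p) (le_ciSup (bddAbove E n v) p)))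
      (fun r u => by
        simp only [map_smul_eq_mul]
        exact (Real.mul_iSup_of_nonneg (norm_nonneg r) _).symm))
    (fun v w => ciSup_le fun p => by
      rw [p.1.block_eq]
      exact max_le_max (le_ciSup (bddAbove E _ v) p) (le_ciSup (bddAbove E _ w) p))
    (fun α v β => ciSup_le fun p => (p.1.sandwich_le α v β).trans (by
      refine mul_le_mul_of_nonneg_right (mul_le_mul_of_nonneg_left ?_ (norm_nonneg _))
        (norm_nonneg _)
      exact le_ciSup (bddAbove E _ v) p))
  eq_zero_of_seminorm := fun n u h => by
    ext i j
    refine DFinsupp.ext fun μ => ?_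
    have h1 : (QuantumSpace.toQuantumSeminorm (E := E μ)).seminorm n (amp (proj E μ) n u) ≤ 0 :=
      (le_ciSup (bddAbove E n u) ⟨_, admissible_proj E μ⟩).trans_eq h
    have h2 := QuantumSpace.eq_zero_of_seminorm n _ (le_antisymm h1 (apply_nonneg _ _))
    exact congrFun (congrFun h2 i) j

theorem inj_completelyContractive (ν : Λ) : CompletelyContractive (inj E ν) :=
  fun n v => ciSup_le fun p => p.2 ν n v

/-- The universal property of the coproduct. -/
theorem existsUnique_desc {Y : Type*} [AddCommGroup Y] [Module ℂ Y] [QuantumSpace Y]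
    (ψ : ∀ ν, E ν →ₗ[ℂ] Y) (hψ : ∀ ν, CompletelyContractive (ψ ν)) :
    ∃! Ψ : L1Sum E →ₗ[ℂ] Y, CompletelyContractive Ψ ∧ ∀ ν, Ψ ∘ₗ inj E ν = ψ ν := by
  classical
  obtain ⟨Ψ, hΨ⟩ : ∃ Ψ : L1Sum E →ₗ[ℂ] Y, ∀ ν, Ψ ∘ₗ inj E ν = ψ ν :=
    ⟨DirectSum.toModule ℂ Λ Y ψ, fun ν => LinearMap.ext fun x => DirectSum.toModule_lof ℂ ν x⟩
  refine ⟨Ψ, ⟨fun n u => ?_, hΨ⟩, fun Φ hΦ => ?_⟩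
  · exact le_ciSup (bddAbove E n u)
      ⟨_, admissible_comap E Ψ fun ν => by rw [hΨ]; exact hψ ν⟩
  · refine DirectSum.linearMap_ext ℂ fun ν => ?_
    exact (hΦ.2 ν).trans (hΨ ν).symm

end L1Sum

end L1Sum

/-- The nuclear-composed quantum space `⊕₁ {N_{d ν}; ν ∈ Λ}` (with all `d ν ≥ 1`). -/
abbrev NuclearComposed {Λ : Type*} (d : Λ → ℕ+) : Type _ :=
  L1Sum fun ν => Nuc (d ν)

end QuantumSpaces

end Quantum

/-! Everything rests on the isometric identification CB(N_n, E) = M_n(E), `cbNorm_nucOp`. The matrix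
`nucUnit n` in M_n(N_n) represents the identity of B(ℂ^n), so it has norm at most 1, and φ ↦
φ_n(`nucUnit n`) is inverse to x ↦ `nucOp x`. Lifting an operator N_n → E along τ with the same cb
norm is therefore lifting a matrix with the same norm, which is exactly what strict coisometry
allows. The lifts on the summands of an ℓ₁-sum are bounded by the norm of the given operator and
glue by the coproduct property; retracts inherit projectivity. Conversely, the operators `nucOp x`,
with x running over the unit balls of all M_n(E), glue to a strict coisometry onto E, and lifting
the identity of a projective P along such a map makes P a retract.

The analytic core is ‖`nucOp x`‖_cb ≤ 1 for ‖x‖ ≤ 1, obtained without representing E on a Hilbert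
space. Let F be a functional on M_k(E), dominated by the norm, that attains the norm at the image of
w ∈ M_k(N_n). Convex separation (`exists_densities`) gives density matrices H, K with 2 Re F(α y γ*)
≤ tr(αα*H) + tr(γγ*K) for ‖y‖ ≤ 1. With H and K replaced by B*B and D*D, B and D invertible, F(α x
β) = g(Bα, βD*), where g is a contractive bilinear form for the Hilbert–Schmidt norms. Its Gram
matrix is a contraction v in M_k(B(ℂ^n)). The amplified operator of w sends v to some Y with ‖Y‖ ≤
‖w‖, and F at the image of w is the form of Y at the vectorised B and conjugate of D, whose norms
are nearly 1. -/

namespace Quantum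

open scoped ENNReal Matrix.Norms.L2Operator ComplexOrder MatrixOrder
open Matrix (vecMulVec trace)

/-! ### Quadratic forms, Hilbert–Schmidt norms and density matrices. -/

section FiniteDimensional

variable {ι κ : Type*} [Fintype ι] [Fintype κ]

theorem norm_dotProduct_mulVec_le [DecidableEq κ] (A : Matrix ι κ ℂ) (x : ι → ℂ) (y : κ → ℂ) :
    ‖x ⬝ᵥ A.mulVec y‖ ≤ ‖A‖ * (√(∑ i, ‖x i‖ ^ 2) * √(∑ j, ‖y j‖ ^ 2)) := by
  have h1 : ‖x ⬝ᵥ A.mulVec y‖ ≤ ∑ i, ‖x i‖ * ‖A.mulVec y i‖ := by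
    refine (norm_sum_le _ _).trans (le_of_eq ?_)
    simp
  refine h1.trans ((Real.sum_mul_le_sqrt_mul_sqrt _ _ _).trans ?_)
  have h2 : √(∑ i, ‖A.mulVec y i‖ ^ 2) ≤ ‖A‖ * √(∑ j, ‖y j‖ ^ 2) := by
    refine (Real.sqrt_le_sqrt (l2_mulVec_le A y)).trans (le_of_eq ?_)
    rw [Real.sqrt_mul (by positivity), Real.sqrt_sq (norm_nonneg _)]
  calc _ ≤ √(∑ i, ‖x i‖ ^ 2) * (‖A‖ * √(∑ j, ‖y j‖ ^ 2)) := by gcongr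
    _ = _ := by ring

theorem re_star_dotProduct_self (x : ι → ℂ) :
    (star x ⬝ᵥ x).re = ∑ i, ‖x i‖ ^ 2 := by
  simp only [dotProduct, Pi.star_apply, Complex.re_sum]
  refine Finset.sum_congr rfl fun i _ => ?_
  rw [RCLike.star_def, Complex.conj_mul', ← Complex.ofReal_pow, Complex.ofReal_re]

/-- At x = `star (A.mulVec y)` the hypothesis reads 2‖Ay‖² ≤ ‖Ay‖² + ‖y‖². The additive bound is the
form in which convex separation delivers its estimate. -/
theorem l2_le_one_of_re_le [DecidableEq κ] (A : Matrix ι κ ℂ)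
    (h : ∀ (x : ι → ℂ) (y : κ → ℂ),
      2 * (x ⬝ᵥ A.mulVec y).re ≤ ∑ i, ‖x i‖ ^ 2 + ∑ j, ‖y j‖ ^ 2) : ‖A‖ ≤ 1 := by
  refine l2_le_of A zero_le_one fun y => ?_
  have h1 := h (star (A.mulVec y)) y
  rw [re_star_dotProduct_self] at h1
  simp only [Pi.star_apply, norm_star] at h1
  linarith

/-- The square of the Hilbert-Schmidt norm. -/
noncomputable def hsSq (A : Matrix ι κ ℂ) : ℝ := ∑ i, ∑ j, ‖A i j‖ ^ 2

theorem hsSq_nonneg (A : Matrix ι κ ℂ) : 0 ≤ hsSq A :=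
  Finset.sum_nonneg fun _ _ => Finset.sum_nonneg fun _ _ => by positivity

theorem re_trace_mul_conjTranspose (A : Matrix ι κ ℂ) :
    (trace (A * A.conjTranspose)).re = hsSq A := by
  simp only [trace, Matrix.diag_apply, Matrix.mul_apply, Matrix.conjTranspose_apply,
    Complex.re_sum, hsSq]
  refine Finset.sum_congr rfl fun i _ => Finset.sum_congr rfl fun j _ => ?_
  rw [RCLike.star_def, Complex.mul_conj', ← Complex.ofReal_pow, Complex.ofReal_re]

/-- A real functional on complex matrices that is nonnegative on rank one projections is given,
on Hermitian matrices, by a positive semidefinite density. -/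
theorem exists_density [DecidableEq κ] (ρ : Matrix κ κ ℂ →ₗ[ℝ] ℝ)
    (hρ : ∀ x : κ → ℂ, 0 ≤ ρ (vecMulVec x (star x))) :
    ∃ H : Matrix κ κ ℂ, H.PosSemidef ∧
      ∀ P : Matrix κ κ ℂ, P.IsHermitian → ρ P = (trace (P * H)).re := by
  -- The entries are forced by Re tr(PK) = ρ(P) at the matrix units and at their multiples by i; the
  -- minus sign comes from Re(iz) = -Im z.
  let K : Matrix κ κ ℂ := Matrix.of fun q p =>
    ⟨ρ (Matrix.single p q 1), -ρ (Matrix.single p q Complex.I)⟩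
  have hK : ∀ P, ρ P = (trace (P * K)).re := by
    intro P
    conv_lhs => rw [Matrix.matrix_eq_sum_single P]
    simp only [trace, Matrix.diag_apply, Matrix.mul_apply, map_sum, Complex.re_sum]
    refine Finset.sum_congr rfl fun p _ => Finset.sum_congr rfl fun q _ => ?_
    have h : Matrix.single p q (P p q) = (P p q).re • Matrix.single p q (1 : ℂ)
        + (P p q).im • Matrix.single p q Complex.I := by
      rw [Matrix.smul_single, Matrix.smul_single, ← Matrix.single_add]
      congr 1
      simp
    rw [h, map_add, map_smul, map_smul]
    simp [K]
  -- On Hermitian P, K and its adjoint give the same values, so K may be replaced by its Hermitian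
  -- part.
  have hKs : ∀ P : Matrix κ κ ℂ, P.IsHermitian → ρ P = (trace (P * K.conjTranspose)).re := by
    intro P hP
    rw [hK, ← Complex.conj_re, ← RCLike.star_def, ← Matrix.trace_conjTranspose,
      Matrix.conjTranspose_mul, hP.eq, Matrix.trace_mul_comm]
  have hH : ∀ P : Matrix κ κ ℂ, P.IsHermitian →
      ρ P = (trace (P * ((1 / 2 : ℂ) • (K + K.conjTranspose)))).re := by
    intro P hP
    rw [Matrix.mul_smul, Matrix.trace_smul, Matrix.mul_add, Matrix.trace_add, smul_eq_mul]
    have h1 := hK P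
    have h2 := hKs P hP
    simp
    linarith
  have hherm : ((1 / 2 : ℂ) • (K + K.conjTranspose)).IsHermitian := by
    unfold Matrix.IsHermitian
    rw [Matrix.conjTranspose_smul, Matrix.conjTranspose_add, Matrix.conjTranspose_conjTranspose,
      add_comm]
    simp
  refine ⟨_, Matrix.PosSemidef.of_dotProduct_mulVec_nonneg hherm fun x => ?_, hH⟩
  have h1 := hρ x
  rw [hH _ (by
    unfold Matrix.IsHermitian
    rw [Matrix.conjTranspose_vecMulVec, star_star]), Matrix.trace_mul_comm,
    Matrix.mul_vecMulVec, Matrix.trace_vecMulVec, dotProduct_comm] at h1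
  exact Complex.nonneg_iff.mpr ⟨h1, by
    have := hherm.im_star_dotProduct_mulVec_self x
    exact this.symm⟩

/-- Positive semidefinite matrices are approximated from above by `Bᴴ * B` with `B` invertible. -/
theorem exists_isUnit_conjTranspose_mul_self [DecidableEq κ] [Nonempty κ]
    {H : Matrix κ κ ℂ} (hH : H.PosSemidef) {ε : ℝ} (hε : 0 < ε) :
    ∃ B : Matrix κ κ ℂ, IsUnit B.det ∧ hsSq B ≤ (trace H).re + ε ∧
      ∀ {μ : Type} [Fintype μ] (α : Matrix κ μ ℂ),
        (trace (α * α.conjTranspose * H)).re ≤ hsSq (B * α) := by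
  -- Adding δ·1 to H makes it positive definite, hence the factor B invertible, at the cost of
  -- exactly ε in the trace.
  obtain ⟨δ, hδ, hδε⟩ : ∃ δ : ℝ, 0 < δ ∧ δ * Fintype.card κ = ε := by
    have : (0 : ℝ) < Fintype.card κ := by exact_mod_cast Fintype.card_pos
    exact ⟨ε / Fintype.card κ, by positivity, by field_simp⟩
  have hpd : (H + (δ : ℂ) • (1 : Matrix κ κ ℂ)).PosDef :=
    Matrix.PosDef.posSemidef_add hH (Matrix.PosDef.one.smul (by exact_mod_cast hδ))
  obtain ⟨B, hB⟩ := CStarAlgebra.nonneg_iff_eq_star_mul_self.mp hpd.posSemidef.nonneg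
  rw [Matrix.star_eq_conjTranspose] at hB
  refine ⟨B, ?_, ?_, fun {μ} _ α => ?_⟩
  · have h1 := hpd.isUnit
    rw [hB, Matrix.isUnit_iff_isUnit_det, Matrix.det_mul] at h1
    exact isUnit_of_mul_isUnit_right h1
  · rw [← re_trace_mul_conjTranspose, Matrix.trace_mul_comm, ← hB, Matrix.trace_add,
      Matrix.trace_smul, Matrix.trace_one, ← hδε]
    simp
  · have h1 : hsSq (B * α) = (trace (α * α.conjTranspose * (B.conjTranspose * B))).re := by
      rw [← re_trace_mul_conjTranspose, Matrix.conjTranspose_mul]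
      congr 1
      rw [Matrix.mul_assoc, Matrix.trace_mul_comm]
      simp only [Matrix.mul_assoc]
    rw [h1, ← hB, Matrix.mul_add, Matrix.trace_add, Complex.add_re, Matrix.mul_smul,
      Matrix.mul_one, Matrix.trace_smul, smul_eq_mul, Complex.re_ofReal_mul,
      re_trace_mul_conjTranspose]
    have := hsSq_nonneg α
    have : 0 ≤ δ * hsSq α := by positivity
    linarith

end FiniteDimensional

/-! ### Hahn–Banach separation: dominating a functional on M_k(E) by a pair of states. -/

section Separation

/-- Matrices whose quadratic form is strictly negative. -/
def strictlyNegative (κ : Type*) [Fintype κ] : Set (Matrix κ κ ℂ) :=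
  {P | ∃ δ : ℝ, 0 < δ ∧ ∀ x : κ → ℂ, (star x ⬝ᵥ P.mulVec x).re ≤ -δ * ∑ i, ‖x i‖ ^ 2}

section

variable {κ : Type*} [Fintype κ]

theorem convex_strictlyNegative : Convex ℝ (strictlyNegative κ) := by
  rintro P ⟨δ, hδ, h⟩ Q ⟨η, hη, h'⟩ a b ha hb hab
  have hpos : 0 < a * δ + b * η := by
    rcases ha.eq_or_lt with rfl | ha
    · rw [zero_add] at hab
      subst hab
      simpa using hη
    · positivity
  refine ⟨a * δ + b * η, hpos, fun x => ?_⟩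
  rw [Matrix.add_mulVec, dotProduct_add, Matrix.smul_mulVec, Matrix.smul_mulVec,
    dotProduct_smul, dotProduct_smul, Complex.add_re, Complex.smul_re, Complex.smul_re,
    smul_eq_mul, smul_eq_mul]
  have h1 := mul_le_mul_of_nonneg_left (h x) ha
  have h2 := mul_le_mul_of_nonneg_left (h' x) hb
  linarith

/-- A perturbation of operator norm below δ/2 uses up at most half of the margin δ. Only the real
part of the form is constrained, so openness holds among all matrices, not just Hermitian ones. -/
theorem isOpen_strictlyNegative [DecidableEq κ] : IsOpen (strictlyNegative κ) := by
  refine Metric.isOpen_iff.mpr ?_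
  rintro P ⟨δ, hδ, h⟩
  refine ⟨δ / 2, by positivity, fun Q hQ => ⟨δ / 2, by positivity, fun x => ?_⟩⟩
  rw [Metric.mem_ball, dist_eq_norm] at hQ
  have h1 : (star x ⬝ᵥ (Q - P).mulVec x).re ≤ δ / 2 * ∑ i, ‖x i‖ ^ 2 := by
    refine (Complex.re_le_norm _).trans ((norm_dotProduct_mulVec_le _ _ _).trans ?_)
    simp only [Pi.star_apply, norm_star]
    rw [Real.mul_self_sqrt (by positivity)]
    exact mul_le_mul_of_nonneg_right hQ.le (by positivity)
  rw [Matrix.sub_mulVec, dotProduct_sub, Complex.sub_re] at h1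
  have h2 := h x
  linarith

theorem smul_mem_strictlyNegative {P : Matrix κ κ ℂ} (hP : P ∈ strictlyNegative κ) {r : ℝ}
    (hr : 0 < r) : r • P ∈ strictlyNegative κ := by
  obtain ⟨δ, hδ, h⟩ := hP
  refine ⟨r * δ, by positivity, fun x => ?_⟩
  rw [Matrix.smul_mulVec, dotProduct_smul, Complex.smul_re, smul_eq_mul]
  have := mul_le_mul_of_nonneg_left (h x) hr.le
  linarith

theorem neg_one_mem_strictlyNegative [DecidableEq κ] : (-1 : Matrix κ κ ℂ) ∈ strictlyNegative κ :=
  ⟨1, one_pos, fun x => by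
    rw [Matrix.neg_mulVec, Matrix.one_mulVec, dotProduct_neg, Complex.neg_re,
      re_star_dotProduct_self, neg_one_mul]⟩

/-- Negativity with margin δ says ‖α*x‖² ≤ (t - δ)‖x‖². Over an empty index set every matrix is
strictly negative and t would be arbitrary. -/
theorem sq_norm_lt_of_mem_strictlyNegative [DecidableEq κ] [Nonempty κ] {μ : Type*}
    [Fintype μ] [DecidableEq μ] {α : Matrix κ μ ℂ} {t : ℝ}
    (h : α * α.conjTranspose - t • (1 : Matrix κ κ ℂ) ∈ strictlyNegative κ) : ‖α‖ ^ 2 < t := by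
  obtain ⟨δ, hδ, h⟩ := h
  have h1 : ∀ x : κ → ℂ, ∑ j, ‖α.conjTranspose.mulVec x j‖ ^ 2 ≤ (t - δ) * ∑ i, ‖x i‖ ^ 2 := by
    intro x
    have h2 := h x
    have hstar : Matrix.vecMul (star x) α = star (α.conjTranspose.mulVec x) := by
      rw [Matrix.star_mulVec, Matrix.conjTranspose_conjTranspose]
    rw [Matrix.sub_mulVec, Matrix.smul_mulVec, Matrix.one_mulVec, dotProduct_sub,
      dotProduct_smul, Complex.sub_re, Complex.smul_re, re_star_dotProduct_self, smul_eq_mul,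
      ← Matrix.mulVec_mulVec, Matrix.dotProduct_mulVec, hstar,
      re_star_dotProduct_self] at h2
    linarith
  -- Test the bound at a basis vector.
  have h0 : 0 ≤ t - δ := by
    obtain ⟨i⟩ := ‹Nonempty κ›
    have := (Finset.sum_nonneg fun _ _ => by positivity).trans (h1 (Pi.single i 1))
    have h3 : ∑ j, ‖(Pi.single i 1 : κ → ℂ) j‖ ^ 2 = 1 := by
      rw [Finset.sum_eq_single i] <;> simp +contextual
    rwa [h3, mul_one] at this
  have h2 : ‖α‖ ≤ √(t - δ) := by
    rw [← Matrix.l2_opNorm_conjTranspose]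
    refine l2_le_of _ (Real.sqrt_nonneg _) fun x => ?_
    rw [Real.sq_sqrt h0]
    exact h1 x
  calc ‖α‖ ^ 2 ≤ √(t - δ) ^ 2 := by gcongr
    _ = t - δ := Real.sq_sqrt h0
    _ < t := by linarith

end

/-- The horizontal concatenation of two matrices. -/
def hcat {κ : Type*} {m n : ℕ} (α : Matrix κ (Fin m) ℂ) (β : Matrix κ (Fin n) ℂ) :
    Matrix κ (Fin (m + n)) ℂ :=
  Matrix.of fun i => Fin.append (α i) (β i)

theorem hcat_mul_conjTranspose {κ : Type*} {m n : ℕ} (α : Matrix κ (Fin m) ℂ)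
    (β : Matrix κ (Fin n) ℂ) :
    hcat α β * (hcat α β).conjTranspose = α * α.conjTranspose + β * β.conjTranspose := by
  ext i j
  simp [hcat, Matrix.mul_apply, Fin.sum_univ_add]

variable {E : Type*} [AddCommGroup E] [Module ℂ E]

/-- A sum of two sandwiches is a single sandwich of a block sum; this is what turns Ruan's first
axiom into convexity. -/
theorem sandwich_hcat {k m n : ℕ} (α γ : Matrix (Fin k) (Fin m) ℂ)
    (α' γ' : Matrix (Fin k) (Fin n) ℂ)
    (v : Matrix (Fin m) (Fin m) E) (w : Matrix (Fin n) (Fin n) E) :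
    sandwich (hcat α α') (blockSum v w) (hcat γ γ').conjTranspose
      = sandwich α v γ.conjTranspose + sandwich α' w γ'.conjTranspose := by
  ext i j
  simp [sandwich, hcat, blockSum, Fin.sum_univ_add]

theorem sandwich_smul_smul {k m : ℕ} (a b : ℂ) (α : Matrix (Fin k) (Fin m) ℂ)
    (v : Matrix (Fin m) (Fin m) E) (β : Matrix (Fin m) (Fin k) ℂ) :
    sandwich (a • α) v (b • β) = (a * b) • sandwich α v β := by
  ext i j
  simp only [sandwich, Matrix.of_apply, Matrix.smul_apply, Finset.smul_sum, smul_smul, smul_eq_mul]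
  refine Finset.sum_congr rfl fun p _ => Finset.sum_congr rfl fun q _ => ?_
  congr 1
  ring

theorem sandwich_zero_left {k m : ℕ} (v : Matrix (Fin m) (Fin m) E)
    (β : Matrix (Fin m) (Fin k) ℂ) : sandwich (0 : Matrix (Fin k) (Fin m) ℂ) v β = 0 := by
  ext i j
  simp [sandwich]

theorem sandwich_zero_right {k m : ℕ} (α : Matrix (Fin k) (Fin m) ℂ)
    (v : Matrix (Fin m) (Fin m) E) : sandwich α v (0 : Matrix (Fin m) (Fin k) ℂ) = 0 := by
  ext i j
  simp [sandwich]

variable [QuantumSpace E]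

/-- The convex set separated from pairs of strictly negative matrices in the proof of
`exists_densities`. -/
def pairingSet {k : ℕ} (F : Matrix (Fin k) (Fin k) E →ₗ[ℂ] ℂ) :
    Set (Matrix (Fin k) (Fin k) ℂ × Matrix (Fin k) (Fin k) ℂ) :=
  {z | ∃ (m : ℕ) (y : Matrix (Fin m) (Fin m) E) (α γ : Matrix (Fin k) (Fin m) ℂ) (s t : ℝ),
    mnorm y ≤ 1 ∧ s + t ≤ 2 * (F (sandwich α y γ.conjTranspose)).re ∧
    z = (α * α.conjTranspose - s • 1, γ * γ.conjTranspose - t • 1)}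

theorem sqrt_smul_mul_conjTranspose {κ μ : Type*} [Fintype μ] (α : Matrix κ μ ℂ)
    {a : ℝ} (ha : 0 ≤ a) :
    ((√a : ℂ) • α) * ((√a : ℂ) • α).conjTranspose = a • (α * α.conjTranspose) := by
  rw [Matrix.conjTranspose_smul, Matrix.smul_mul, Matrix.mul_smul, smul_smul]
  have : (√a : ℂ) * star (√a : ℂ) = a := by
    rw [RCLike.star_def, Complex.conj_ofReal, ← Complex.ofReal_mul, Real.mul_self_sqrt ha]
  rw [this]
  rfl

/-- A convex combination is realised by y ⊕ y', still in the unit ball, with coefficients scaled by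
√a and √b. The size m is left free in `pairingSet` for this purpose. -/
theorem convex_pairingSet {k : ℕ} (F : Matrix (Fin k) (Fin k) E →ₗ[ℂ] ℂ) :
    Convex ℝ (pairingSet F) := by
  rintro _ ⟨m, y, α, γ, s, t, hy, hst, rfl⟩ _ ⟨m', y', α', γ', s', t', hy', hst', rfl⟩ a b ha hb -
  refine ⟨m + m', blockSum y y', hcat ((√a : ℂ) • α) ((√b : ℂ) • α'),
    hcat ((√a : ℂ) • γ) ((√b : ℂ) • γ'), a * s + b * s', a * t + b * t', ?_, ?_, ?_⟩
  · exact (QuantumSpace.toQuantumSeminorm.block_eq y y').trans_le (max_le hy hy')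
  · have hsq : ∀ c : ℝ, 0 ≤ c → (√c : ℂ) * star (√c : ℂ) = c := fun c hc => by
      rw [RCLike.star_def, Complex.conj_ofReal, ← Complex.ofReal_mul, Real.mul_self_sqrt hc]
    rw [sandwich_hcat, Matrix.conjTranspose_smul, Matrix.conjTranspose_smul, sandwich_smul_smul,
      sandwich_smul_smul, hsq a ha, hsq b hb, map_add, map_smul, map_smul, smul_eq_mul,
      smul_eq_mul, Complex.add_re, Complex.re_ofReal_mul, Complex.re_ofReal_mul]
    have h1 := mul_le_mul_of_nonneg_left hst ha
    have h2 := mul_le_mul_of_nonneg_left hst' hb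
    linarith
  · rw [hcat_mul_conjTranspose, hcat_mul_conjTranspose, sqrt_smul_mul_conjTranspose _ ha,
      sqrt_smul_mul_conjTranspose _ hb, sqrt_smul_mul_conjTranspose _ ha,
      sqrt_smul_mul_conjTranspose _ hb]
    ext : 1
    · simp only [Prod.fst_add, Prod.smul_fst]
      module
    · simp only [Prod.snd_add, Prod.smul_snd]
      module

/-- A common point would give ‖α‖² + ‖γ‖² < s + t ≤ 2 Re F(α y γ*) ≤ 2‖α‖‖γ‖, the last step by
Ruan's second axiom. -/
theorem disjoint_pairingSet {k : ℕ} [NeZero k] (F : Matrix (Fin k) (Fin k) E →ₗ[ℂ] ℂ)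
    (hF : ∀ y, (F y).re ≤ mnorm y) :
    Disjoint (strictlyNegative (Fin k) ×ˢ strictlyNegative (Fin k)) (pairingSet F) := by
  rw [Set.disjoint_left]
  rintro _ ⟨h1, h2⟩ ⟨m, y, α, γ, s, t, hy, hst, rfl⟩
  have ha := sq_norm_lt_of_mem_strictlyNegative h1
  have hb := sq_norm_lt_of_mem_strictlyNegative h2
  have h3 := (hF _).trans (QuantumSpace.toQuantumSeminorm.sandwich_le α y γ.conjTranspose)
  rw [Matrix.l2_opNorm_conjTranspose] at h3
  have h4 : ‖α‖ * mnorm y * ‖γ‖ ≤ ‖α‖ * 1 * ‖γ‖ := by gcongr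
  change (F (sandwich α y γ.conjTranspose)).re ≤ ‖α‖ * mnorm y * ‖γ‖ at h3
  nlinarith [sq_nonneg (‖α‖ - ‖γ‖)]

theorem exists_separating {κ : Type*} [Fintype κ] [DecidableEq κ]
    (U C : Set (Matrix κ κ ℂ × Matrix κ κ ℂ))
    (hU : Convex ℝ U) (hUo : IsOpen U) (hC : Convex ℝ C) (h : Disjoint U C) :
    ∃ (f : Matrix κ κ ℂ × Matrix κ κ ℂ →L[ℝ] ℝ) (u : ℝ),
      (∀ a ∈ U, f a < u) ∧ ∀ b ∈ C, u ≤ f b :=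
  geometric_hahn_banach_open hU hUo hC h

/-- A contractive functional on `M_k(E)` is dominated by a pair of states. -/
theorem exists_densities {k : ℕ} [NeZero k] (F : Matrix (Fin k) (Fin k) E →ₗ[ℂ] ℂ)
    (hF : ∀ y, (F y).re ≤ mnorm y) :
    ∃ H K : Matrix (Fin k) (Fin k) ℂ, H.PosSemidef ∧ K.PosSemidef ∧
      (trace H).re = 1 ∧ (trace K).re = 1 ∧
      ∀ (m : ℕ) (y : Matrix (Fin m) (Fin m) E) (α γ : Matrix (Fin k) (Fin m) ℂ), mnorm y ≤ 1 →
        2 * (F (sandwich α y γ.conjTranspose)).re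
          ≤ (trace (α * α.conjTranspose * H)).re + (trace (γ * γ.conjTranspose * K)).re := by
  obtain ⟨f, u, hfu, huf⟩ := exists_separating _ _
    (convex_strictlyNegative.prod convex_strictlyNegative)
    (isOpen_strictlyNegative.prod isOpen_strictlyNegative)
    (convex_pairingSet F) (disjoint_pairingSet F hF)
  have hneg := neg_one_mem_strictlyNegative (κ := Fin k)
  -- The open set is a cone, so f can stay below u on it only if u ≥ 0: scaling (-1, -1) to the
  -- value u/2 contradicts u < 0.
  have hu : 0 ≤ u := by
    by_contra! hu
    set c := f (-1, -1) with hc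
    have hlt : ∀ r : ℝ, 0 < r → r * c < u := fun r hr => by
      rw [hc, ← smul_eq_mul, ← map_smul]
      exact hfu _ ⟨smul_mem_strictlyNegative hneg hr, smul_mem_strictlyNegative hneg hr⟩
    have hc0 : c < 0 := by simpa using (hlt 1 one_pos).trans hu
    have := hlt (u / (2 * c)) (by apply div_pos_of_neg_of_neg <;> linarith)
    have h2 : u / (2 * c) * c = u / 2 := by
      have := hc0.ne
      field_simp
    linarith
  let ρ : Matrix (Fin k) (Fin k) ℂ →ₗ[ℝ] ℝ :=
    f.toLinearMap ∘ₗ LinearMap.inl ℝ (Matrix (Fin k) (Fin k) ℂ) (Matrix (Fin k) (Fin k) ℂ)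
  let σ : Matrix (Fin k) (Fin k) ℂ →ₗ[ℝ] ℝ :=
    f.toLinearMap ∘ₗ LinearMap.inr ℝ (Matrix (Fin k) (Fin k) ℂ) (Matrix (Fin k) (Fin k) ℂ)
  have hf : ∀ P Q, f (P, Q) = ρ P + σ Q := fun P Q => by
    change f (P, Q) = f (P, 0) + f (0, Q)
    rw [← map_add]
    simp
  have main : ∀ (m : ℕ) (y : Matrix (Fin m) (Fin m) E) (α γ : Matrix (Fin k) (Fin m) ℂ) (s t : ℝ),
      mnorm y ≤ 1 → s + t ≤ 2 * (F (sandwich α y γ.conjTranspose)).re →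
      s * ρ 1 + t * σ 1 ≤ ρ (α * α.conjTranspose) + σ (γ * γ.conjTranspose) := by
    intro m y α γ s t hy hst
    have := hu.trans (huf _ ⟨m, y, α, γ, s, t, hy, hst, rfl⟩)
    rw [hf, map_sub, map_sub, map_smul, map_smul, smul_eq_mul, smul_eq_mul] at this
    linarith
  have h0 : ∀ m : ℕ, mnorm (0 : Matrix (Fin m) (Fin m) E) ≤ 1 := fun m =>
    (map_zero (QuantumSpace.toQuantumSeminorm.seminorm m)).trans_le zero_le_one
  -- Sandwiches of size m = 0 put every (-s·1, -t·1) with s + t ≤ 0 into the convex set; s = -t = ±1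
  -- gives both inequalities.
  have hρσ : ρ 1 = σ 1 := by
    have h1 := main 0 0 0 0 1 (-1) (h0 0) (by simp [sandwich_zero_left])
    have h2 := main 0 0 0 0 (-1) 1 (h0 0) (by simp [sandwich_zero_left])
    simp at h1 h2
    linarith
  have hρ1 : 0 < ρ 1 := by
    have h1 := (hfu (-1, -1) ⟨hneg, hneg⟩)
    have h2 := huf 0 ⟨0, 0, 0, 0, 0, 0, h0 0, by simp [sandwich_zero_left], by simp; rfl⟩
    rw [map_zero] at h2
    rw [hf, map_neg, map_neg, ← hρσ] at h1
    linarith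
  -- Rank one projections arise as αα* for a column α, so y = 0 and s = t = 0 give positivity of ρ
  -- and σ.
  have hvec : ∀ x : Fin k → ℂ, vecMulVec x (star x)
      = (Matrix.of fun i (_ : Fin 1) => x i)
        * (Matrix.of fun i (_ : Fin 1) => x i).conjTranspose := by
    intro x
    ext i j
    simp [Matrix.vecMulVec_apply, Matrix.mul_apply]
  have hρ : ∀ x : Fin k → ℂ, 0 ≤ ((ρ 1)⁻¹ • ρ) (vecMulVec x (star x)) := fun x => by
    have := main 1 0 (Matrix.of fun i (_ : Fin 1) => x i) 0 0 0 (h0 1)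
      (by simp [sandwich_zero_right])
    rw [← hvec] at this
    simp only [zero_mul, add_zero, map_zero, Matrix.zero_mul] at this
    exact mul_nonneg (inv_nonneg.mpr hρ1.le) this
  have hσ : ∀ x : Fin k → ℂ, 0 ≤ ((ρ 1)⁻¹ • σ) (vecMulVec x (star x)) := fun x => by
    have := main 1 0 0 (Matrix.of fun i (_ : Fin 1) => x i) 0 0 (h0 1)
      (by simp [sandwich_zero_left])
    rw [← hvec] at this
    simp only [zero_mul, zero_add, add_zero, map_zero, Matrix.zero_mul] at this
    exact mul_nonneg (inv_nonneg.mpr hρ1.le) this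
  obtain ⟨H, hH, hHρ⟩ := exists_density _ hρ
  obtain ⟨K, hK, hKσ⟩ := exists_density _ hσ
  refine ⟨H, K, hH, hK, ?_, ?_, fun m y α γ hy => ?_⟩
  · have := hHρ 1 Matrix.isHermitian_one
    rw [one_mul, LinearMap.smul_apply, smul_eq_mul, inv_mul_cancel₀ hρ1.ne'] at this
    exact this.symm
  · have := hKσ 1 Matrix.isHermitian_one
    rw [one_mul, LinearMap.smul_apply, smul_eq_mul, ← hρσ, inv_mul_cancel₀ hρ1.ne'] at this
    exact this.symm
  · rw [← hHρ _ (Matrix.isHermitian_mul_conjTranspose_self α),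
      ← hKσ _ (Matrix.isHermitian_mul_conjTranspose_self γ), LinearMap.smul_apply,
      LinearMap.smul_apply, ← smul_add, smul_eq_mul, ← div_eq_inv_mul, le_div_iff₀ hρ1]
    -- Both s and t are taken to be Re F(α y γ*).
    refine le_trans (le_of_eq ?_) (main m y α γ _ (F (sandwich α y γ.conjTranspose)).re hy
      (two_mul _).ge)
    rw [← hρσ]
    ring

end Separation

/-! ### The operators N_n → E given by a matrix, and the estimate of their cb norm. -/

section Nuclear

/-- Hahn–Banach over ℝ from the line through x₀, followed by complexification, which keeps the real
part. -/
theorem exists_dual_of_seminorm {V : Type*} [AddCommGroup V] [Module ℂ V] (p : Seminorm ℂ V)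
    (x₀ : V) : ∃ F : V →ₗ[ℂ] ℂ, (∀ x, (F x).re ≤ p x) ∧ (F x₀).re = p x₀ := by
  have hsmul : ∀ (c : ℝ) (x : V), p (c • x) = |c| * p x := fun c x => by
    rw [← Complex.coe_smul, map_smul_eq_mul, Complex.norm_real, Real.norm_eq_abs]
  have H : ∀ c : ℝ, c • x₀ = 0 → (RingHom.id ℝ) c • p x₀ = 0 := fun c hc => by
    rcases smul_eq_zero.mp hc with h | h
    · simp [h]
    · simp [h]
  let f : V →ₗ.[ℝ] ℝ := LinearPMap.mkSpanSingleton' x₀ (p x₀) H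
  obtain ⟨g, hg, hgp⟩ := exists_extension_of_le_sublinear f p
    (fun c hc x => by rw [hsmul, abs_of_pos hc]) (fun x y => map_add_le_add p x y) (by
      rintro ⟨y, hy⟩
      obtain ⟨c, rfl⟩ := Submodule.mem_span_singleton.mp hy
      refine (LinearPMap.mkSpanSingleton'_apply x₀ (p x₀) H c hy).trans_le ?_
      change c * p x₀ ≤ p (c • x₀)
      rw [hsmul]
      exact mul_le_mul_of_nonneg_right (le_abs_self c) (apply_nonneg p x₀))
  have hre : ∀ x, ((Module.Dual.extendRCLike g : V →ₗ[ℂ] ℂ) x).re = g x :=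
    fun x => Module.Dual.re_extendRCLike_apply (𝕜 := ℂ) g x
  refine ⟨Module.Dual.extendRCLike g, fun x => (hre x).trans_le (hgp x), (hre x₀).trans ?_⟩
  have hmem : x₀ ∈ Submodule.span ℝ {x₀} := Submodule.mem_span_singleton_self x₀
  exact (hg ⟨x₀, hmem⟩).trans (LinearPMap.mkSpanSingleton'_apply_self x₀ (p x₀) H hmem)

theorem sum_comm_pairs {ι κ μ ν : Type*} [Fintype ι] [Fintype κ] [Fintype μ] [Fintype ν]
    (f : ι → κ → μ → ν → ℂ) :
    ∑ i, ∑ j, ∑ a, ∑ b, f i j a b = ∑ a, ∑ b, ∑ i, ∑ j, f i j a b :=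
  calc _ = ∑ x : ι × κ, ∑ y : μ × ν, f x.1 x.2 y.1 y.2 := by simp only [Fintype.sum_prod_type]
    _ = ∑ y : μ × ν, ∑ x : ι × κ, f x.1 x.2 y.1 y.2 := Finset.sum_comm
    _ = _ := by simp only [Fintype.sum_prod_type]

section Gram

variable {κ ν κ' ν' : Type*} [Fintype κ] [Fintype ν] [Fintype κ'] [Fintype ν']
  [DecidableEq κ] [DecidableEq ν] [DecidableEq κ'] [DecidableEq ν']

/-- The matrix of a bilinear form on a pair of matrix spaces. -/
def gram (g : Matrix κ ν ℂ →ₗ[ℂ] Matrix ν' κ' ℂ →ₗ[ℂ] ℂ) : Matrix (κ × ν) (κ' × ν') ℂ :=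
  Matrix.of fun p q => g (Matrix.single p.1 p.2 1) (Matrix.single q.2 q.1 1)

theorem bilinear_eq_gram (g : Matrix κ ν ℂ →ₗ[ℂ] Matrix ν' κ' ℂ →ₗ[ℂ] ℂ) (α : Matrix κ ν ℂ)
    (β : Matrix ν' κ' ℂ) :
    g α β = (fun p : κ × ν => α p.1 p.2) ⬝ᵥ
      (gram g).mulVec (fun q : κ' × ν' => β q.2 q.1) := by
  have h1 : ∀ a i, Matrix.single a i (α a i) = α a i • Matrix.single a i 1 := by simp
  have h2 : ∀ j b, Matrix.single j b (β j b) = β j b • Matrix.single j b 1 := by simp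
  conv_lhs => rw [Matrix.matrix_eq_sum_single α, Matrix.matrix_eq_sum_single β]
  simp only [map_sum, LinearMap.sum_apply, dotProduct, Matrix.mulVec, gram, Matrix.of_apply,
    Fintype.sum_prod_type, h1, h2, map_smul, LinearMap.smul_apply, smul_eq_mul, Finset.mul_sum]
  rw [sum_comm_pairs]
  refine Finset.sum_congr rfl fun a _ => Finset.sum_congr rfl fun i _ => ?_
  rw [Finset.sum_comm]
  refine Finset.sum_congr rfl fun b _ => Finset.sum_congr rfl fun j _ => ?_
  ring

/-- Vectorising matrices turns Hilbert–Schmidt norms into Euclidean ones, so `l2_le_one_of_re_le`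
applies. -/
theorem gram_norm_le_one (g : Matrix κ ν ℂ →ₗ[ℂ] Matrix ν' κ' ℂ →ₗ[ℂ] ℂ)
    (h : ∀ α β, 2 * (g α β).re ≤ hsSq α + hsSq β.conjTranspose) : ‖gram g‖ ≤ 1 := by
  refine l2_le_one_of_re_le _ fun x y => ?_
  have h1 := h (Matrix.of fun a i => x (a, i)) (Matrix.of fun j b => y (b, j))
  rw [bilinear_eq_gram] at h1
  refine h1.trans_eq ?_
  simp [hsSq, Fintype.sum_prod_type]

end Gram

variable {E : Type*} [AddCommGroup E] [Module ℂ E]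

/-- The scalar bilinear form `(α, β) ↦ F (α x β)`. -/
def sandwichForm {k n : ℕ} (F : Matrix (Fin k) (Fin k) E →ₗ[ℂ] ℂ) (x : Matrix (Fin n) (Fin n) E) :
    Matrix (Fin k) (Fin n) ℂ →ₗ[ℂ] Matrix (Fin n) (Fin k) ℂ →ₗ[ℂ] ℂ :=
  LinearMap.mk₂ ℂ (fun α β => F (sandwich α x β))
    (fun α α' β => by
      rw [← map_add]
      congr 1
      ext i j
      simp [sandwich, add_mul, add_smul, Finset.sum_add_distrib])
    (fun c α β => by
      rw [← map_smul]
      congr 1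
      ext i j
      simp [sandwich, Finset.smul_sum, smul_smul, mul_assoc])
    (fun α β β' => by
      rw [← map_add]
      congr 1
      ext i j
      simp [sandwich, mul_add, add_smul, Finset.sum_add_distrib])
    (fun c α β => by
      rw [← map_smul]
      congr 1
      ext i j
      simp [sandwich, Finset.smul_sum, smul_smul, mul_left_comm])

/-- The operator `N_n → E` with matrix `x` of values at the matrix units (transposed). -/
noncomputable def nucOp {n : ℕ} (x : Matrix (Fin n) (Fin n) E) : Nuc n →ₗ[ℂ] E where
  toFun b := ∑ i, ∑ j, Nuc.toMatrix n b i j • x j i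
  map_add' b c := by simp [add_smul, Finset.sum_add_distrib]
  map_smul' c b := by simp [Finset.smul_sum, smul_smul]

theorem nucOp_apply {n : ℕ} (x : Matrix (Fin n) (Fin n) E) (b : Nuc n) :
    nucOp x b = ∑ i, ∑ j, Nuc.toMatrix n b i j • x j i :=
  rfl

/-- Expresses the amplification through sandwiches of x, the only elements on which
`exists_densities` controls a functional. -/
theorem amp_nucOp {k n : ℕ} (x : Matrix (Fin n) (Fin n) E) (w : Matrix (Fin k) (Fin k) (Nuc n)) :
    amp (nucOp x) k w = ∑ p, ∑ q, ∑ i, ∑ j, Nuc.toMatrix n (w p q) i j •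
      sandwich (Matrix.single p j 1) x (Matrix.single i q 1) := by
  have hs : ∀ (p q : Fin k) (i j : Fin n),
      sandwich (Matrix.single p j 1) x (Matrix.single i q 1) = Matrix.single p q (x j i) := by
    intro p q i j
    ext r s
    simp only [sandwich, Matrix.of_apply, Matrix.single_apply]
    by_cases hp : p = r <;> by_cases hq : q = s <;> simp [hp, hq]
  conv_lhs => rw [Matrix.matrix_eq_sum_single (amp (nucOp x) k w)]
  refine Finset.sum_congr rfl fun p _ => Finset.sum_congr rfl fun q _ => ?_
  have h : amp (nucOp x) k w p q = ∑ i, ∑ j, Nuc.toMatrix n (w p q) i j • x j i := rfl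
  simp only [hs, h, Matrix.smul_single]
  ext r s
  simp only [Matrix.single_apply, Matrix.sum_apply]
  split_ifs <;> simp

theorem tracePairing_apply {n : ℕ} (b : Nuc n) (a : MatOp n) :
    tracePairing n b a = ∑ i, ∑ j, Nuc.toMatrix n b i j * MatOp.toMatrix n a j i :=
  rfl

variable [QuantumSpace E]

/-- A norming functional, factored through its two densities, turns x into a contraction v in
M_k(B(ℂ^n)), on which the cb norm defining ‖w‖ can be tested. -/
theorem mnorm_amp_nucOp_le_of_le_one {k n : ℕ} {x : Matrix (Fin n) (Fin n) E} (hx : mnorm x ≤ 1)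
    (w : Matrix (Fin k) (Fin k) (Nuc n)) : mnorm (amp (nucOp x) k w) ≤ mnorm w := by
  rcases Nat.eq_zero_or_pos k with rfl | hk
  · rw [Subsingleton.elim (amp (nucOp x) 0 w) 0]
    exact (map_zero (QuantumSpace.toQuantumSeminorm.seminorm 0)).trans_le (mnorm_nonneg w)
  have : NeZero k := ⟨hk.ne'⟩
  obtain ⟨F, hF, hFw⟩ := exists_dual_of_seminorm
    (QuantumSpace.toQuantumSeminorm.seminorm k) (amp (nucOp x) k w)
  obtain ⟨H, K, hH, hK, hH1, hK1, hHK⟩ := exists_densities F hF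
  -- The densities may be singular; ε pays for invertible factors B and D.
  suffices h : ∀ ε : ℝ, 0 < ε → mnorm (amp (nucOp x) k w) ≤ mnorm w * (1 + ε) by
    have hlim : Filter.Tendsto (fun ε : ℝ => mnorm w * (1 + ε)) (nhdsWithin 0 (Set.Ioi 0))
        (nhds (mnorm w * (1 + 0))) :=
      ((by fun_prop : Continuous fun ε : ℝ => mnorm w * (1 + ε)).tendsto 0).mono_left
        nhdsWithin_le_nhds
    rw [add_zero, mul_one] at hlim
    exact ge_of_tendsto hlim (eventually_nhdsWithin_of_forall h)
  intro ε hε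
  obtain ⟨B, hB, hBtr, hBα⟩ := exists_isUnit_conjTranspose_mul_self hH hε
  obtain ⟨D, hD, hDtr, hDα⟩ := exists_isUnit_conjTranspose_mul_self hK hε
  rw [hH1] at hBtr
  rw [hK1] at hDtr
  -- The form (α, β) ↦ F(α x β) after the change of variables B⁻¹, D⁻¹ that turns the densities into
  -- Hilbert–Schmidt norms.
  let g : Matrix (Fin k) (Fin n) ℂ →ₗ[ℂ] Matrix (Fin n) (Fin k) ℂ →ₗ[ℂ] ℂ :=
    (sandwichForm F x).compl₁₂ (mulLeftLinearMap (Fin n) ℂ B⁻¹)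
      (mulRightLinearMap (Fin n) ℂ D⁻¹.conjTranspose)
  have hg : ‖gram g‖ ≤ 1 := by
    refine gram_norm_le_one g fun α β => ?_
    have h1 := hHK n x (B⁻¹ * α) (D⁻¹ * β.conjTranspose) hx
    rw [Matrix.conjTranspose_mul, Matrix.conjTranspose_conjTranspose] at h1
    refine (show 2 * (g α β).re ≤ _ from h1).trans (add_le_add ?_ ?_)
    · simpa [Matrix.mul_nonsing_inv_cancel_left _ _ hB] using hBα (B⁻¹ * α)
    · simpa [Matrix.mul_nonsing_inv_cancel_left _ _ hD] using hDα (D⁻¹ * β.conjTranspose)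
  have hG : ∀ α β, F (sandwich α x β) = g (B * α) (β * D.conjTranspose) := by
    intro α β
    change F (sandwich α x β)
      = F (sandwich (B⁻¹ * (B * α)) x (β * D.conjTranspose * D⁻¹.conjTranspose))
    rw [Matrix.nonsing_inv_mul_cancel_left _ _ hB, Matrix.mul_assoc,
      ← Matrix.conjTranspose_mul, Matrix.nonsing_inv_mul _ hD, Matrix.conjTranspose_one,
      Matrix.mul_one]
  let v : Matrix (Fin k) (Fin k) (MatOp n) := Matrix.of fun a b =>
    (MatOp.toMatrix n).symm (Matrix.of fun i j => gram g (a, i) (b, j))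
  have hv : flatten v = gram g := rfl
  let Y := flatten (amp (dualOp w) k v)
  have hY : ‖Y‖ ≤ mnorm w := by
    refine (flatten_amp_dualOp_le w v).trans ?_
    rw [hv]
    exact mul_le_of_le_one_right (mnorm_nonneg w) hg
  have hYapp : ∀ a b p q, Y (a, p) (b, q)
      = ∑ i, ∑ j, Nuc.toMatrix n (w p q) i j * gram g (a, j) (b, i) := fun a b p q => rfl
  -- Against matrix units, Bα and βD* only pick out entries of B and of conjugate D; the entries of
  -- w then contract the Gram matrix to Y.
  have hFY : F (amp (nucOp x) k w) = (fun r : Fin k × Fin k => B r.1 r.2) ⬝ᵥ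
      Y.mulVec (fun r : Fin k × Fin k => star (D r.1 r.2)) := by
    have hL : ∀ p q i j, F (sandwich (Matrix.single p j 1) x (Matrix.single i q 1))
        = ∑ a, ∑ b, B a p * (gram g (a, j) (b, i) * star (D b q)) := by
      intro p q i j
      have h1 : ∀ a j', (B * Matrix.single p j (1 : ℂ)) a j' = if j = j' then B a p else 0 := by
        intro a j'
        by_cases h : j = j' <;> simp [Matrix.mul_apply, Matrix.single_apply, h]
      have h2 : ∀ i' b, (Matrix.single i q (1 : ℂ) * D.conjTranspose) i' b
          = if i = i' then star (D b q) else 0 := by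
        intro i' b
        by_cases h : i = i' <;> simp [Matrix.mul_apply, Matrix.single_apply, h]
      rw [hG, bilinear_eq_gram]
      simp [dotProduct, Matrix.mulVec, Fintype.sum_prod_type, h1, h2, Finset.mul_sum]
    rw [amp_nucOp]
    simp only [map_sum, map_smul, smul_eq_mul, hL, dotProduct, Matrix.mulVec,
      Fintype.sum_prod_type, hYapp, Finset.mul_sum, Finset.sum_mul]
    conv_rhs =>
      enter [2, a]
      rw [Finset.sum_comm]
    conv_rhs => rw [← sum_comm_pairs]
    refine Finset.sum_congr rfl fun p _ => Finset.sum_congr rfl fun q _ => ?_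
    rw [sum_comm_pairs]
    refine Finset.sum_congr rfl fun a _ => Finset.sum_congr rfl fun b _ => ?_
    refine Finset.sum_congr rfl fun i _ => Finset.sum_congr rfl fun j _ => ?_
    ring
  calc mnorm (amp (nucOp x) k w) = (F (amp (nucOp x) k w)).re := hFw.symm
    _ ≤ ‖F (amp (nucOp x) k w)‖ := Complex.re_le_norm _
    _ ≤ ‖Y‖ * (√(hsSq B) * √(hsSq D)) := by
      rw [hFY]
      refine (norm_dotProduct_mulVec_le _ _ _).trans_eq ?_
      simp [hsSq, Fintype.sum_prod_type]
    _ ≤ mnorm w * (√(1 + ε) * √(1 + ε)) := by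
      have := mnorm_nonneg w
      gcongr
    _ = mnorm w * (1 + ε) := by rw [Real.mul_self_sqrt (by positivity)]

end Nuclear

/-! ### Calculus of cb norms and norm-preserving lifts of matrices. -/

section CBNorm

variable {G F E : Type*} [AddCommGroup G] [Module ℂ G] [AddCommGroup F] [Module ℂ F]
  [AddCommGroup E] [Module ℂ E]

theorem amp_apply (φ : F →ₗ[ℂ] E) {n : ℕ} (v : Matrix (Fin n) (Fin n) F) (i j : Fin n) :
    amp φ n v i j = φ (v i j) :=
  rfl

theorem amp_comp (φ : F →ₗ[ℂ] E) (ψ : G →ₗ[ℂ] F) {n : ℕ} (v : Matrix (Fin n) (Fin n) G) :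
    amp (φ ∘ₗ ψ) n v = amp φ n (amp ψ n v) :=
  rfl

theorem amp_smul (c : ℂ) (φ : F →ₗ[ℂ] E) {n : ℕ} (v : Matrix (Fin n) (Fin n) F) :
    amp (c • φ) n v = c • amp φ n v :=
  rfl

variable [QuantumSpace G] [QuantumSpace F] [QuantumSpace E]

theorem mnorm_zero (n : ℕ) : mnorm (0 : Matrix (Fin n) (Fin n) E) = 0 :=
  map_zero (QuantumSpace.toQuantumSeminorm.seminorm n)

theorem eq_zero_of_mnorm_eq_zero {n : ℕ} {v : Matrix (Fin n) (Fin n) E} (h : mnorm v = 0) :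
    v = 0 :=
  QuantumSpace.eq_zero_of_seminorm n v h

theorem le_cbNorm (φ : F →ₗ[ℂ] E) {n : ℕ} {v : Matrix (Fin n) (Fin n) F} (hv : mnorm v ≤ 1) :
    ENNReal.ofReal (mnorm (amp φ n v)) ≤ cbNorm φ :=
  (le_iSup₂ (f := fun (v : Matrix (Fin n) (Fin n) F) (_ : mnorm v ≤ 1) =>
    ENNReal.ofReal (mnorm (amp φ n v))) v hv).trans (le_iSup (fun n => ampNorm φ n) n)

theorem completelyContractive_iff {φ : F →ₗ[ℂ] E} : CompletelyContractive φ ↔ cbNorm φ ≤ 1 := by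
  constructor
  · intro h
    simpa using cbNorm_le zero_le_one fun n v => (h n v).trans_eq (one_mul _).symm
  · intro h n v
    refine (mnorm_amp_le (h.trans_lt ENNReal.one_lt_top) v).trans ?_
    exact mul_le_of_le_one_left (mnorm_nonneg v) (ENNReal.toReal_le_of_le_ofReal zero_le_one
      (by simpa using h))

theorem CompletelyContractive.completelyBounded {φ : F →ₗ[ℂ] E} (h : CompletelyContractive φ) :
    CompletelyBounded φ :=
  (completelyContractive_iff.mp h).trans_lt ENNReal.one_lt_top

theorem CompletelyContractive.comp {φ : F →ₗ[ℂ] E} {ψ : G →ₗ[ℂ] F} (hφ : CompletelyContractive φ)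
    (hψ : CompletelyContractive ψ) : CompletelyContractive (φ ∘ₗ ψ) :=
  fun n v => (hφ n _).trans (hψ n v)

theorem completelyContractive_id : CompletelyContractive (LinearMap.id : E →ₗ[ℂ] E) :=
  fun _ _ => le_rfl

theorem CompletelyContractive.cbNorm_comp_le_right {φ : F →ₗ[ℂ] E} (hφ : CompletelyContractive φ)
    (ψ : G →ₗ[ℂ] F) : cbNorm (φ ∘ₗ ψ) ≤ cbNorm ψ :=
  iSup_mono fun n => iSup₂_mono fun v _ => ENNReal.ofReal_le_ofReal (hφ n (amp ψ n v))

theorem CompletelyContractive.cbNorm_comp_le_left {ψ : G →ₗ[ℂ] F} (hψ : CompletelyContractive ψ)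
    (φ : F →ₗ[ℂ] E) : cbNorm (φ ∘ₗ ψ) ≤ cbNorm φ :=
  iSup_le fun n => iSup₂_le fun v hv => le_cbNorm φ (v := amp ψ n v) ((hψ n v).trans hv)

theorem mnorm_ofReal_smul {r : ℝ} (hr : 0 ≤ r) {n : ℕ} (v : Matrix (Fin n) (Fin n) E) :
    mnorm ((r : ℂ) • v) = r * mnorm v := by
  rw [mnorm_smul, Complex.norm_real, Real.norm_of_nonneg hr]

theorem exists_mnorm_le_one_smul {n : ℕ} (v : Matrix (Fin n) (Fin n) E) :
    ∃ w, mnorm w ≤ 1 ∧ v = (mnorm v : ℂ) • w := by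
  rcases (mnorm_nonneg v).eq_or_lt with h | h
  · exact ⟨0, (mnorm_zero n).trans_le zero_le_one, by
      rw [smul_zero, eq_zero_of_mnorm_eq_zero h.symm]⟩
  · refine ⟨((mnorm v)⁻¹ : ℝ) • v, ?_, ?_⟩
    · rw [← Complex.coe_smul, mnorm_ofReal_smul (by positivity), inv_mul_cancel₀ h.ne']
    · rw [← Complex.coe_smul, smul_smul, ← Complex.ofReal_mul, mul_inv_cancel₀ h.ne',
        Complex.ofReal_one, one_smul]

theorem CompletelyStrictlyCoisometric.completelyContractive {τ : F →ₗ[ℂ] E}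
    (hτ : CompletelyStrictlyCoisometric τ) : CompletelyContractive τ := by
  intro n v
  obtain ⟨w, hw, hv⟩ := exists_mnorm_le_one_smul v
  have h1 : mnorm (amp τ n w) ≤ 1 := (hτ n).subset ⟨w, hw, rfl⟩
  conv_lhs => rw [hv]
  rw [map_smul, mnorm_ofReal_smul (mnorm_nonneg v)]
  exact mul_le_of_le_one_right (mnorm_nonneg v) h1

/-- Rescaled from the closed unit ball. Surjectivity onto that ball gives a lift of norm at most
that of v, and contractivity of τ the reverse inequality. -/
theorem CompletelyStrictlyCoisometric.exists_lift {τ : F →ₗ[ℂ] E}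
    (hτ : CompletelyStrictlyCoisometric τ) {n : ℕ} (v : Matrix (Fin n) (Fin n) E) :
    ∃ w, amp τ n w = v ∧ mnorm w = mnorm v := by
  obtain ⟨v', hv', hv⟩ := exists_mnorm_le_one_smul v
  obtain ⟨w, hw, hwv⟩ := (hτ n).superset hv'
  have h : amp τ n ((mnorm v : ℂ) • w) = v := by rw [map_smul, hwv, ← hv]
  refine ⟨(mnorm v : ℂ) • w, h, le_antisymm ?_ ?_⟩
  · rw [mnorm_ofReal_smul (mnorm_nonneg v)]
    exact mul_le_of_le_one_right (mnorm_nonneg v) hw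
  · exact (congrArg mnorm h).ge.trans (hτ.completelyContractive n _)

end CBNorm

/-! ### CB(N_n, E) = M_n(E) and projectivity of N_n. -/

section NuclearOperators

variable {E : Type*} [AddCommGroup E] [Module ℂ E]

/-- The matrix of `M_n(N_n)` corresponding to the identity operator of `B(ℂ^n)`. -/
noncomputable def nucUnit (n : ℕ) : Matrix (Fin n) (Fin n) (Nuc n) :=
  Matrix.of fun i j => (Nuc.toMatrix n).symm (Matrix.single j i 1)

/-- Since tr(E_ji a) = a_ij, the associated operator is the identity of B(ℂ^n). -/
theorem mnorm_nucUnit_le (n : ℕ) : mnorm (nucUnit n) ≤ 1 := by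
  refine toReal_cbNorm_dualOp_le _ zero_le_one fun m v => ?_
  rw [one_mul]
  refine le_of_eq (congrArg norm ?_)
  ext ⟨p, i⟩ ⟨q, j⟩
  rw [flatten_amp_dualOp, tracePairing_apply, flatten_apply]
  simp only [nucUnit, Matrix.of_apply, LinearEquiv.apply_symm_apply, Matrix.single_apply, ite_and,
    ite_mul, one_mul, zero_mul]
  simp

theorem amp_nucOp_nucUnit {n : ℕ} (x : Matrix (Fin n) (Fin n) E) :
    amp (nucOp x) n (nucUnit n) = x := by
  ext i j
  rw [amp_apply, nucOp_apply]
  simp only [nucUnit, Matrix.of_apply, LinearEquiv.apply_symm_apply, Matrix.single_apply, ite_and,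
    ite_smul, one_smul, zero_smul]
  simp

theorem nucOp_amp_nucUnit {n : ℕ} (φ : Nuc n →ₗ[ℂ] E) : nucOp (amp φ n (nucUnit n)) = φ := by
  refine LinearMap.ext fun b => ?_
  rw [nucOp_apply]
  have hb : b = ∑ i, ∑ j, Nuc.toMatrix n b i j •
      (Nuc.toMatrix n).symm (Matrix.single i j (1 : ℂ)) := by
    refine (Nuc.toMatrix n).injective ?_
    simp only [map_sum, map_smul, LinearEquiv.apply_symm_apply]
    conv_lhs => rw [Matrix.matrix_eq_sum_single (Nuc.toMatrix n b)]
    simp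
  conv_rhs => rw [hb]
  simp only [map_sum, map_smul]
  rfl

theorem comp_nucOp {F : Type*} [AddCommGroup F] [Module ℂ F] (τ : F →ₗ[ℂ] E) {n : ℕ}
    (x : Matrix (Fin n) (Fin n) F) : τ ∘ₗ nucOp x = nucOp (amp τ n x) := by
  refine LinearMap.ext fun b => ?_
  simp only [LinearMap.comp_apply, nucOp_apply, map_sum, map_smul, amp_apply]

variable [QuantumSpace E]

theorem mnorm_amp_nucOp_le {k n : ℕ} (x : Matrix (Fin n) (Fin n) E)
    (w : Matrix (Fin k) (Fin k) (Nuc n)) : mnorm (amp (nucOp x) k w) ≤ mnorm x * mnorm w := by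
  obtain ⟨y, hy, hx⟩ := exists_mnorm_le_one_smul x
  have h : amp (nucOp x) k w = (mnorm x : ℂ) • amp (nucOp y) k w := by
    -- The scalar itself contains x, so it must be made opaque before x is eliminated.
    generalize (mnorm x : ℂ) = c at hx ⊢
    subst hx
    ext i j
    simp [amp_apply, nucOp_apply, Finset.smul_sum, smul_smul, mul_comm]
  rw [h, mnorm_ofReal_smul (mnorm_nonneg x)]
  exact mul_le_mul_of_nonneg_left (mnorm_amp_nucOp_le_of_le_one hy w) (mnorm_nonneg x)

/-- The isometric identification `CB(N_n, E) = M_n(E)`. -/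
theorem cbNorm_nucOp {n : ℕ} (x : Matrix (Fin n) (Fin n) E) :
    cbNorm (nucOp x) = ENNReal.ofReal (mnorm x) := by
  refine le_antisymm (cbNorm_le (mnorm_nonneg x) fun k w => mnorm_amp_nucOp_le x w) ?_
  simpa only [amp_nucOp_nucUnit] using le_cbNorm (nucOp x) (mnorm_nucUnit_le n)

/-- Lift the matrix representing φ with its norm; the operator it represents is the required lift.
-/
theorem metricallyProjective_nuc.{v} (n : ℕ) : MetricallyProjective.{v} (Nuc n) := by
  intro F E _ _ _ _ _ _ τ φ hτ hφ
  obtain ⟨y, hy, hnorm⟩ := hτ.exists_lift (amp φ n (nucUnit n))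
  have h : cbNorm (nucOp y) = cbNorm φ := by
    rw [cbNorm_nucOp, hnorm, ← cbNorm_nucOp, nucOp_amp_nucUnit]
  refine ⟨nucOp y, h.trans_lt hφ, ?_, h⟩
  rw [comp_nucOp, hy, nucOp_amp_nucUnit]

end NuclearOperators

/-! ### Sums, retracts and coverings by nuclear-composed spaces. -/

section Projectivity

theorem L1Sum.hom_ext {Λ : Type*} {E : Λ → Type*} [∀ ν, AddCommGroup (E ν)] [∀ ν, Module ℂ (E ν)]
    {Y : Type*} [AddCommGroup Y] [Module ℂ Y] {φ ψ : L1Sum E →ₗ[ℂ] Y}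
    (h : ∀ ν, φ ∘ₗ L1Sum.inj E ν = ψ ∘ₗ L1Sum.inj E ν) : φ = ψ := by
  refine LinearMap.ext fun x => ?_
  induction x using L1Sum.induction with
  | zero => rw [map_zero, map_zero]
  | inj ν x => exact LinearMap.congr_fun (h ν) x
  | add x y hx hy => rw [map_add, map_add, hx, hy]

/-- An operator on an `ℓ₁`-sum has the completely bounded norm at most `C` as soon as its
restrictions to the summands do. -/
theorem L1Sum.exists_desc {Λ : Type*} {E : Λ → Type*} [∀ ν, AddCommGroup (E ν)]
    [∀ ν, Module ℂ (E ν)] [∀ ν, QuantumSpace (E ν)] {Y : Type*} [AddCommGroup Y] [Module ℂ Y]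
    [QuantumSpace Y] (ψ : ∀ ν, E ν →ₗ[ℂ] Y) {C : ℝ} (hC : 0 ≤ C)
    (hψ : ∀ ν, cbNorm (ψ ν) ≤ ENNReal.ofReal C) :
    ∃ Ψ : L1Sum E →ₗ[ℂ] Y, cbNorm Ψ ≤ ENNReal.ofReal C ∧ ∀ ν, Ψ ∘ₗ inj E ν = ψ ν := by
  have hb : ∀ ν n (v : Matrix (Fin n) (Fin n) (E ν)), mnorm (amp (ψ ν) n v) ≤ C * mnorm v :=
    fun ν n v => (mnorm_amp_le ((hψ ν).trans_lt ENNReal.ofReal_lt_top) v).trans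
      (mul_le_mul_of_nonneg_right (ENNReal.toReal_le_of_le_ofReal hC (hψ ν)) (mnorm_nonneg v))
  -- The coproduct property concerns contractions only, hence the rescaling. For C = 0 the inverse
  -- is 0 by convention, and all ψ ν vanish anyway.
  obtain ⟨Ψ, ⟨hΨ, hΨinj⟩, -⟩ := existsUnique_desc E (fun ν => ((C⁻¹ : ℝ) : ℂ) • ψ ν)
    (fun ν n v => by
      rw [amp_smul, mnorm_ofReal_smul (inv_nonneg.mpr hC)]
      refine (mul_le_mul_of_nonneg_left (hb ν n v) (inv_nonneg.mpr hC)).trans ?_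
      rw [← mul_assoc]
      exact mul_le_of_le_one_left (mnorm_nonneg v) (inv_mul_le_one))
  refine ⟨(C : ℂ) • Ψ, cbNorm_le hC fun n v => ?_, fun ν => ?_⟩
  · rw [amp_smul, mnorm_ofReal_smul hC]
    exact mul_le_mul_of_nonneg_left (hΨ n v) hC
  · rw [LinearMap.smul_comp, hΨinj, smul_smul, ← Complex.ofReal_mul]
    rcases eq_or_ne C 0 with rfl | h
    · refine LinearMap.ext fun x => ?_
      have h0 := hb ν 1 (Matrix.of fun _ _ => x)
      rw [zero_mul] at h0
      have h1 := congrFun (congrFun (eq_zero_of_mnorm_eq_zero (h0.antisymm (mnorm_nonneg _))) 0) 0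
      rw [zero_mul, Complex.ofReal_zero, zero_smul]
      exact h1.symm
    · rw [mul_inv_cancel₀ h, Complex.ofReal_one, one_smul]

/-- Lifts of the restrictions share the bound ‖φ‖_cb and glue with it; τ being contractive, the
glued lift has no smaller norm. -/
theorem metricallyProjective_l1Sum.{v} {Λ : Type*} {P : Λ → Type*} [∀ ν, AddCommGroup (P ν)]
    [∀ ν, Module ℂ (P ν)] [∀ ν, QuantumSpace (P ν)]
    (hP : ∀ ν, MetricallyProjective.{v} (P ν)) : MetricallyProjective.{v} (L1Sum P) := by
  intro F E _ _ _ _ _ _ τ φ hτ hφ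
  have hle : ∀ ν, cbNorm (φ ∘ₗ L1Sum.inj P ν) ≤ cbNorm φ := fun ν =>
    (L1Sum.inj_completelyContractive P ν).cbNorm_comp_le_left φ
  choose ψ _ hτψ hψ using fun ν => hP ν F E τ (φ ∘ₗ L1Sum.inj P ν) hτ ((hle ν).trans_lt hφ)
  obtain ⟨Ψ, hΨ, hinj⟩ := L1Sum.exists_desc ψ (C := (cbNorm φ).toReal) ENNReal.toReal_nonneg
    (fun ν => by rw [ENNReal.ofReal_toReal hφ.ne, hψ]; exact hle ν)
  rw [ENNReal.ofReal_toReal hφ.ne] at hΨ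
  have hτΨ : τ ∘ₗ Ψ = φ := L1Sum.hom_ext fun ν => by rw [LinearMap.comp_assoc, hinj, hτψ]
  refine ⟨Ψ, hΨ.trans_lt hφ, hτΨ, le_antisymm hΨ ?_⟩
  rw [← hτΨ]
  exact hτ.completelyContractive.cbNorm_comp_le_right Ψ

theorem MetricallyProjective.of_isRetract.{v} {P X : Type*} [AddCommGroup P] [Module ℂ P]
    [QuantumSpace P] [AddCommGroup X] [Module ℂ X] [QuantumSpace X]
    (hX : MetricallyProjective.{v} X) (h : IsRetract P X) : MetricallyProjective.{v} P := by
  obtain ⟨σ, ρ, hσ, hρ, hσρ⟩ := h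
  intro F E _ _ _ _ _ _ τ φ hτ hφ
  obtain ⟨ψ, -, hτψ, hψ⟩ := hX F E τ (φ ∘ₗ σ) hτ ((hσ.cbNorm_comp_le_left φ).trans_lt hφ)
  have hle : cbNorm (ψ ∘ₗ ρ) ≤ cbNorm φ :=
    ((hρ.cbNorm_comp_le_left ψ).trans_eq hψ).trans (hσ.cbNorm_comp_le_left φ)
  have hlift : τ ∘ₗ ψ ∘ₗ ρ = φ := by
    rw [← LinearMap.comp_assoc, hτψ, LinearMap.comp_assoc, hσρ, LinearMap.comp_id]
  refine ⟨ψ ∘ₗ ρ, hle.trans_lt hφ, hlift, le_antisymm hle ?_⟩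
  conv_lhs => rw [← hlift]
  exact hτ.completelyContractive.cbNorm_comp_le_right _

theorem MetricallyProjective.isRetract.{v} {P : Type v} {X : Type v} [AddCommGroup P] [Module ℂ P]
    [QuantumSpace P] [AddCommGroup X] [Module ℂ X] [QuantumSpace X]
    (hP : MetricallyProjective.{v} P) {τ : X →ₗ[ℂ] P} (hτ : CompletelyStrictlyCoisometric τ) :
    IsRetract P X := by
  obtain ⟨ρ, -, hτρ, hρ⟩ := hP X P τ LinearMap.id hτ completelyContractive_id.completelyBounded
  refine ⟨τ, ρ, hτ.completelyContractive, ?_, hτρ⟩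
  -- Only ‖id‖_cb ≤ 1 is used, since the norm is 0 when P = 0.
  rw [completelyContractive_iff, hρ, ← completelyContractive_iff]
  exact completelyContractive_id

/-- The projection is ρσ; conversely σ is π followed by the inverse of ι on its range. -/
theorem isRetract_iff_isDirectSummand {P X : Type*} [AddCommGroup P] [Module ℂ P]
    [QuantumSpace P] [AddCommGroup X] [Module ℂ X] [QuantumSpace X] :
    IsRetract P X ↔ IsDirectSummand P X := by
  constructor
  · rintro ⟨σ, ρ, hσ, hρ, hσρ⟩
    have hσρ' : ∀ p, σ (ρ p) = p := LinearMap.congr_fun hσρ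
    refine ⟨ρ, ρ ∘ₗ σ, fun n v => le_antisymm (hρ n v) ?_, ⟨fun x => ⟨σ x, rfl⟩, ?_⟩, fun hP => ?_⟩
    · have h := hσ n (amp ρ n v)
      rwa [← amp_comp, hσρ] at h
    · rintro _ ⟨p, rfl⟩
      rw [LinearMap.comp_apply, hσρ']
    · have hcc := hρ.comp hσ
      refine le_antisymm (completelyContractive_iff.mp hcc) ?_
      obtain ⟨p, hp⟩ := exists_ne (0 : P)
      -- A nonzero vector fixed by the projection forces its norm to be at least 1.
      let v : Matrix (Fin 1) (Fin 1) X := Matrix.of fun _ _ => ρ p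
      have hv : amp (ρ ∘ₗ σ) 1 v = v := by
        ext i j
        change ρ (σ (ρ p)) = ρ p
        rw [hσρ']
      have hpos : 0 < mnorm v := (mnorm_nonneg v).lt_of_ne' fun h => hp <| by
        have h1 : ρ p = 0 := congrFun (congrFun (eq_zero_of_mnorm_eq_zero h) 0) 0
        rw [← hσρ' p, h1, map_zero]
      have h1 := mnorm_amp_le hcc.completelyBounded v
      rw [hv] at h1
      have h2 := one_le_of_le_mul_right₀ hpos h1
      rwa [← ENNReal.ofReal_le_iff_le_toReal hcc.completelyBounded.ne, ENNReal.ofReal_one] at h2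
  · rintro ⟨ι, π, hι, hπ, hnorm⟩
    have hinj : Function.Injective ι := by
      refine (injective_iff_map_eq_zero ι).mpr fun p hp => ?_
      let v : Matrix (Fin 1) (Fin 1) P := Matrix.of fun _ _ => p
      have hv : amp ι 1 v = 0 := by
        ext i j
        exact hp
      have h := hι 1 v
      rw [hv, mnorm_zero] at h
      exact congrFun (congrFun (eq_zero_of_mnorm_eq_zero h.symm) 0) 0
    let σ : X →ₗ[ℂ] P := (LinearEquiv.ofInjective ι hinj).symm.toLinearMap ∘ₗ
      π.codRestrict (LinearMap.range ι) hπ.map_mem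
    have hισ : ι ∘ₗ σ = π := LinearMap.ext fun x =>
      congrArg Subtype.val ((LinearEquiv.ofInjective ι hinj).apply_symm_apply
        (π.codRestrict (LinearMap.range ι) hπ.map_mem x))
    refine ⟨σ, ι, fun n v => ?_, fun n v => (hι n v).le, LinearMap.ext fun p => hinj ?_⟩
    -- For P = 0 nothing is known about ‖π‖_cb, but then σ = 0.
    · rcases subsingleton_or_nontrivial P with hP | hP
      · rw [Subsingleton.elim (amp σ n v) 0, mnorm_zero]
        exact mnorm_nonneg v
      · rw [← hι, ← amp_comp, hισ]
        exact completelyContractive_iff.mpr (hnorm hP).le n v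
    · exact (LinearMap.congr_fun hισ (ι p)).trans (hπ.map_id _ ⟨p, rfl⟩)

/-- Every quantum space is a completely strictly coisometric image of a nuclear-composed one. -/
theorem exists_nuclearComposed_coisometric.{v} (E : Type v) [AddCommGroup E] [Module ℂ E]
    [QuantumSpace E] : ∃ (Λ : Type v) (d : Λ → ℕ+) (τ : NuclearComposed d →ₗ[ℂ] E),
      CompletelyStrictlyCoisometric τ := by
  let Λ : Type v := Σ n : ℕ+, {x : Matrix (Fin n) (Fin n) E // mnorm x ≤ 1}
  let d : Λ → ℕ+ := fun l => l.1
  obtain ⟨τ, hτ, hinj⟩ := L1Sum.exists_desc (E := fun l : Λ => Nuc (d l))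
    (fun l => nucOp l.2.1) zero_le_one (fun l => by
      rw [cbNorm_nucOp]
      exact ENNReal.ofReal_le_ofReal l.2.2)
  rw [ENNReal.ofReal_one, ← completelyContractive_iff] at hτ
  refine ⟨Λ, d, τ, fun n => Set.Subset.antisymm ?_ fun x hx => ?_⟩
  · rintro _ ⟨v, hv, rfl⟩
    exact (hτ n v).trans hv
  · rcases Nat.eq_zero_or_pos n with rfl | hn
    -- Size 0 has no summand of its own, and M_0(E) = 0 needs none.
    · exact ⟨0, (mnorm_zero 0).trans_le zero_le_one, Subsingleton.elim _ _⟩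
    · let l : Λ := ⟨⟨n, hn⟩, ⟨x, hx⟩⟩
      -- In the summand indexed by x, the universal matrix `nucUnit n` is mapped to x.
      refine ⟨amp (L1Sum.inj (fun l : Λ => Nuc (d l)) l) n (nucUnit n),
        ?_, ?_⟩
      · exact (L1Sum.inj_completelyContractive (fun l : Λ => Nuc (d l)) l n (nucUnit n)).trans
          (mnorm_nucUnit_le n)
      · exact (congrArg (fun φ => amp φ n (nucUnit n)) (hinj l)).trans (amp_nucOp_nucUnit x)

end Projectivity

end Quantum

theorem corollary5p10 :
    -- every quantum space is a completely strictly coisometric image of a nuclear-composed one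
    (∀ (E : Type u) [AddCommGroup E] [Module ℂ E] [Quantum.QuantumSpace E],
      ∃ (Λ : Type u) (d : Λ → ℕ+) (τ : Quantum.NuclearComposed d →ₗ[ℂ] E),
        Quantum.CompletelyStrictlyCoisometric τ) ∧
    -- metrically projective spaces are the retracts of nuclear-composed spaces, equivalently
    -- the direct summands of such spaces with natural projection of norm one
    (∀ (P : Type u) [AddCommGroup P] [Module ℂ P] [Quantum.QuantumSpace P],
      (Quantum.MetricallyProjective.{u} P ↔
        ∃ (Λ : Type u) (d : Λ → ℕ+), Quantum.IsRetract P (Quantum.NuclearComposed d)) ∧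
      (Quantum.MetricallyProjective.{u} P ↔
        ∃ (Λ : Type u) (d : Λ → ℕ+), Quantum.IsDirectSummand P (Quantum.NuclearComposed d))) ∧
    -- all `N_n` are metrically projective
    (∀ n : ℕ+, Quantum.MetricallyProjective.{u} (Quantum.Nuc n)) := by
  have key : ∀ (P : Type u) [AddCommGroup P] [Module ℂ P] [Quantum.QuantumSpace P],
      Quantum.MetricallyProjective.{u} P ↔
        ∃ (Λ : Type u) (d : Λ → ℕ+), Quantum.IsRetract P (Quantum.NuclearComposed d) := by
    intro P _ _ _
    constructor
    · intro hP
      obtain ⟨Λ, d, τ, hτ⟩ := Quantum.exists_nuclearComposed_coisometric P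
      exact ⟨Λ, d, hP.isRetract hτ⟩
    · rintro ⟨Λ, d, h⟩
      exact (Quantum.metricallyProjective_l1Sum fun ν =>
        Quantum.metricallyProjective_nuc (d ν)).of_isRetract h
  refine ⟨fun E _ _ _ => Quantum.exists_nuclearComposed_coisometric E,
    fun P _ _ _ => ⟨key P, ?_⟩, fun n => Quantum.metricallyProjective_nuc n⟩
  simp only [← Quantum.isRetract_iff_isDirectSummand]
  exact key P
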